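/- A dimension function is a function $\phi\colon(0,1)\to(0,\infty)$ such that, as $R$ decreases to $0$, $\phi(R)\log(1/R)$ increases to $\infty$ and $\phi(R)$ decreases (both monotonicities in the weak sense). For a non-empty bounded set $F\subset\mathbb{R}$ let $N_r(E)$ be the least number of open balls of radius $r$ with centres in $F$ needed to cover $E\subseteq F$, let $B(x,R)$ denote the open ball, and set $$\dim_A^{\phi}F=\inf\Bigl\{s\in\mathbb{R}:\exists C>0\ \forall\, 0<R<1\ \ \sup_{x\in F}N_{R^{1+\phi(R)}}(F\cap B(x,R))\le C R^{-\phi(R)s}\Bigr\},$$ $$\dim_A F=\inf\Bigl\{s\in\mathbb{R}:\exists C>0\ \forall\, 0<r\le R<1\ \ \sup_{x\in F}N_{r}(F\cap B(x,R))\le C (R/r)^{s}\Bigr\}.$$ **(1)** Let $0<r<1$, let $S_i(x)=rx+d_i$ ($i\in I$, $I$ finite, $d_i\in\mathbb{R}$) be maps of the real line, and let $K$ be the associated self-similar set, i.e. the non-empty compact set with $K=\bigcup_{i\in I}S_i(K)$. Put $$\widetilde M_n=\sup_{x\in K}\#\{g : g=S_{i_1}\circ\cdots\circ S_{i_n}\text{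 for some }(i_1,\dots,i_n)\in I^n,\ g(K)\cap B(x,r^n)\ne\varnothing\}.$$ If $\phi$ is a dimension function with $$\lim_{n\to\infty}\frac{\log\widetilde M_n}{n\,\phi(r^n)}=0,$$ then $\dim_A^{\phi}K=\dim_H K$. **(2)** Let $m\ge 3$ be an integer. Define $n_1=1$, $r_1=1$ and, recursively for $k\ge1$, with $N_k=n_1+\cdots+n_k$, let $n_{k+1}$ be the least natural number $n$ with $m^{1-n}\le r_k$, and let $r_{k+1}=(1+m^{-2})\,r_k\,m^{-N_k}$. Let $t=\sum_{k\ge1}m^{-N_k}$. Then $0<t<1$, and the self-similar set $K\subset\mathbb{R}$ of the three maps $$x\mapsto\frac{x}{m},\qquad x\mapsto\frac{x+t}{m},\qquad x\mapsto\frac{x+1}{m},$$ each of contraction ratio $1/m$, has the following property: there is a constant $C_m>0$ such that every dimension function $\phi$ with $$\limsup_{n\to\infty}\frac{\log n}{n\,\phi(m^{-n})}\ge C_m$$ satisfies $\dim_A^{\phi}K=\dim_A K=1$. -/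

import Mathlib

open scoped ENNReal Topology

noncomputable section

/-- A dimension function: a positive function on `(0,1)` (values elsewhere are irrelevant) such that
`φ(R) log (1/R)` increases (weakly) to infinity as `R` decreases to `0`, and
`φ(R)` decreases (weakly) as `R` decreases to `0`. -/
structure IsDimensionFunction (φ : ℝ → ℝ) : Prop where
  pos : ∀ R ∈ Set.Ioo (0 : ℝ) 1, 0 < φ R
  gap_antitone : AntitoneOn (fun R => φ R * Real.log (1 / R)) (Set.Ioo 0 1)
  gap_tendsto : Filter.Tendsto (fun R => φ R * Real.log (1 / R)) (𝓝[>] 0) Filter.atTop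
  monotone : MonotoneOn φ (Set.Ioo 0 1)

/-- `N_r(E)` for a subset `E` of the metric space `F`: the smallest number of open balls of radius
`r`, with centres in `F`, that are needed to cover `E` (`⊤` if no finite cover exists). -/
def openCoveringNumber {X : Type*} [PseudoMetricSpace X] (F E : Set X) (r : ℝ) : ℕ∞ :=
  ⨅ (T : Finset X) (_ : (T : Set X) ⊆ F) (_ : E ⊆ ⋃ y ∈ T, Metric.ball y r), (T.card : ℕ∞)

/-- The Assouad dimension of `F`, as an infimum of real exponents taken in `EReal`. -/
def assouadDim {X : Type*} [PseudoMetricSpace X] (F : Set X) : EReal :=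
  ⨅ s ∈ {s : ℝ | ∃ C : ℝ, 0 < C ∧ ∀ r R : ℝ, 0 < r → r ≤ R → R < 1 → ∀ x ∈ F,
    (openCoveringNumber F (F ∩ Metric.ball x R) r : ℝ≥0∞) ≤ ENNReal.ofReal (C * (R / r) ^ s)},
  (s : EReal)

/-- The `φ`-Assouad dimension of `F`, in which the lower scale is `R ^ (1 + φ R)`. -/
def phiAssouadDim {X : Type*} [PseudoMetricSpace X] (φ : ℝ → ℝ) (F : Set X) : EReal :=
  ⨅ s ∈ {s : ℝ | ∃ C : ℝ, 0 < C ∧ ∀ R : ℝ, 0 < R → R < 1 → ∀ x ∈ F,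
    (openCoveringNumber F (F ∩ Metric.ball x R) (R ^ (1 + φ R)) : ℝ≥0∞)
      ≤ ENNReal.ofReal (C * R ^ (-φ R * s))},
  (s : EReal)

/-- The equicontractive iterated function system `S_i(x) = r x + d_i` on the line. -/
def equiIFS {ι : Type*} (r : ℝ) (d : ι → ℝ) (i : ι) (x : ℝ) : ℝ := r * x + d i

/-- `K` is the self-similar set (attractor) of the system `S`. -/
structure IsAttractor {ι : Type*} (S : ι → ℝ → ℝ) (K : Set ℝ) : Prop where
  nonempty : K.Nonempty
  isCompact : IsCompact K
  eq_iUnion : K = ⋃ i, S i '' K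

/-- The composition `S_{i_1} ∘ ⋯ ∘ S_{i_n}` for the word `[i_1, …, i_n]`. -/
def wordMap {ι : Type*} (S : ι → ℝ → ℝ) : List ι → ℝ → ℝ
  | [] => id
  | i :: w => S i ∘ wordMap S w

/-- The set of distinct maps `g = S_{i_1} ∘ ⋯ ∘ S_{i_n}` for which `g(K)` meets `B(x, ρ)`. -/
def cylinderMaps {ι : Type*} (S : ι → ℝ → ℝ) (K : Set ℝ) (n : ℕ) (x ρ : ℝ) : Set (ℝ → ℝ) :=
  {g | ∃ w : List ι, w.length = n ∧ g = wordMap S w ∧ (g '' K ∩ Metric.ball x ρ).Nonempty}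

/-- The number `M̃_n` for the system `S_i(x) = r x + d_i` with attractor `K`. For a finite index
type `ι` all the counts are at most `(Nat.card ι) ^ n`, so this is an honest supremum. -/
def overlapCount {ι : Type*} (r : ℝ) (d : ι → ℝ) (K : Set ℝ) (n : ℕ) : ℕ :=
  ⨆ x : K, (cylinderMaps (equiIFS r d) K n x (r ^ n)).ncard

/-- The least natural number `n` with `m ^ (1 - n) ≤ ρ` (it exists for `m ≥ 2` and `ρ > 0`). -/
def leastExponent (m : ℕ) (ρ : ℝ) : ℕ := sInf {n : ℕ | (m : ℝ) / (m : ℝ) ^ n ≤ ρ}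

/-- The pairs `(N_k, ρ_k)`, with the index `k` starting at `0`: `N_0 = 1`, `ρ_0 = 1`,
`N_{k+1} = N_k + n_{k+1}` where `n_{k+1}` is the least `n` with `m ^ (1 - n) ≤ ρ_k`, and
`ρ_{k+1} = (1 + 1 / m²) ρ_k m ^ (-N_k)`. -/
def digitData (m : ℕ) : ℕ → ℕ × ℝ
  | 0 => (1, 1)
  | k + 1 =>
    ((digitData m k).1 + leastExponent m (digitData m k).2,
      (1 + 1 / (m : ℝ) ^ 2) * (digitData m k).2 / (m : ℝ) ^ (digitData m k).1)

/-- The number `t = ∑ₖ m ^ (-N_k)`, whose base-`m` digits are `1` exactly at the places `N_k`. -/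
def sparseDigitNumber (m : ℕ) : ℝ := ∑' k : ℕ, 1 / (m : ℝ) ^ (digitData m k).1

/-- The translations of the three maps `x / m`, `(x + t) / m`, `(x + 1) / m`,
where `t` is the number `sparseDigitNumber m`. -/
def threeTranslations (m : ℕ) : Fin 3 → ℝ :=
  ![0, sparseDigitNumber m / (m : ℝ), 1 / (m : ℝ)]

end

/-! Write G = φ(R) log(1/R), so that R^{1+φ(R)} = R e^{-G} and R^{-φ(R)s} = e^{Gs}, with G → ∞ as R
→ 0.

Part (1), upper bound. If r^{n+1} < R ≤ r^n, the ball B(x,R) meets at most M̃_n distinct cylinders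
g(K), each a copy of K scaled by r^n. For t > dim_H K each copy needs at most a constant times
e^{Gt} balls, and the hypothesis makes M̃_n at most a constant times e^{εG}
(`exists_overlapCount_le`). The uniform covers of K hold without separation
(`IsAttractor.exists_covers_of_dimH_lt`): a maximal separated set in K yields a subsystem of
well-separated cylinders, and a Hölder map of its attractor onto [0,1] bounds their number
(`card_le_rpow_of_dimH_lt`). Lower bound. B(x,R) contains a cylinder of size comparable to R;
rescaling a cover of the ball covers K by balls of radius about e^{-G}
(`IsAttractor.dimH_le_of_cover`).

Part (2). The digit places satisfy 2N_k - 1 ≤ N_{k+1} ≤ 2N_k. Truncating t after N_k gives a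
translation that is also reachable by maps x/m and (x+1)/m alone, and the error is about
m^{-N_{k+1}}. Two equally scaled copies of K therefore differ by a tiny shift. If a copy fills an
interval finely, the two shifted copies fill one longer by a factor 1 + 1/m at the same mesh.
Iterating j times (`exists_fillsInterval`) costs only exp(O(j)) levels, so at scale m^{-n} the
relative mesh can be a negative power of n. A suitable upper bound on G by a multiple of log n for
infinitely many n then forces dimension 1. -/

/-! ### The coding map of an equicontractive system -/

/-- The point of the line with address `w` for the maps `x ↦ q x + e i`. -/
noncomputable def codingMap {ι : Type*} (q : ℝ) (e : ι → ℝ) (w : ℕ → ι) : ℝ :=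
  ∑' i, e (w i) * q ^ i

section Coding

variable {ι : Type*} [Finite ι] {q : ℝ} (e : ι → ℝ)

lemma exists_abs_le_of_finite : ∃ M : ℝ, 0 ≤ M ∧ ∀ i, |e i| ≤ M := by
  obtain ⟨M, hM⟩ := (Set.finite_range fun i => |e i|).bddAbove
  exact ⟨max M 0, le_max_right _ _, fun i => (hM ⟨i, rfl⟩).trans (le_max_left _ _)⟩

lemma summable_codingMap (hq : 0 < q) (hq1 : q < 1) (w : ℕ → ι) :
    Summable fun i => e (w i) * q ^ i := by
  obtain ⟨M, -, hM⟩ := exists_abs_le_of_finite e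
  refine Summable.of_norm_bounded ((summable_geometric_of_lt_one hq.le hq1).mul_left M) fun i => ?_
  rw [norm_mul, Real.norm_eq_abs, Real.norm_eq_abs, abs_of_pos (pow_pos hq i)]
  exact mul_le_mul_of_nonneg_right (hM _) (pow_pos hq i).le

lemma codingMap_eq_shift (hq : 0 < q) (hq1 : q < 1) (w : ℕ → ι) :
    codingMap q e w = q * codingMap q e (fun i => w (i + 1)) + e (w 0) := by
  rw [codingMap, (summable_codingMap e hq hq1 w).tsum_eq_zero_add, codingMap, ← tsum_mul_left,
    add_comm]
  simp only [pow_zero, mul_one, pow_succ]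
  congr 2
  ext i
  ring

lemma continuous_codingMap [TopologicalSpace ι] [DiscreteTopology ι] (hq : 0 < q) (hq1 : q < 1) :
    Continuous (codingMap q e) := by
  obtain ⟨M, -, hM⟩ := exists_abs_le_of_finite e
  refine continuous_tsum (u := fun i => M * q ^ i) (fun i => ?_)
    ((summable_geometric_of_lt_one hq.le hq1).mul_left M) fun i w => ?_
  · exact (continuous_of_discreteTopology.comp (continuous_apply i)).mul continuous_const
  · rw [norm_mul, Real.norm_eq_abs, Real.norm_eq_abs, abs_of_pos (pow_pos hq i)]
    exact mul_le_mul_of_nonneg_right (hM _) (pow_pos hq i).le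

/-- A partial sum plus x q^n is the image of x ∈ K under a word of length n; the series is the limit
of such points and K is closed. -/
lemma codingMap_mem {K : Set ℝ} (hK : IsClosed K) (hne : K.Nonempty)
    (hinv : ∀ i, ∀ x ∈ K, q * x + e i ∈ K) (hq : 0 < q) (hq1 : q < 1) (w : ℕ → ι) :
    codingMap q e w ∈ K := by
  obtain ⟨x, hx⟩ := hne
  have hmem : ∀ n : ℕ, ∀ w : ℕ → ι, ∀ x ∈ K,
      (∑ i ∈ Finset.range n, e (w i) * q ^ i) + x * q ^ n ∈ K := by
    intro n
    induction n with
    | zero => intro w x hx; simpa using hx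
    | succ n ih =>
      intro w x hx
      convert ih w _ (hinv (w n) x hx) using 1
      rw [Finset.sum_range_succ]; ring
  have hlim := (summable_codingMap e hq hq1 w).hasSum.tendsto_sum_nat.add
    ((tendsto_pow_atTop_nhds_zero_of_lt_one hq.le hq1).const_mul x)
  rw [mul_zero, add_zero] at hlim
  exact hK.mem_of_tendsto hlim (Filter.Eventually.of_forall fun n => hmem n w x hx)

/-- Every finite non-empty equicontractive system on the line has an attractor. -/
lemma exists_isAttractor [Nonempty ι] (hq : 0 < q) (hq1 : q < 1) :
    ∃ K : Set ℝ, IsAttractor (equiIFS q e) K := by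
  -- With the discrete topology on the finite alphabet, the space of addresses is compact, hence so
  -- is its continuous image.
  let _ : TopologicalSpace ι := ⊥
  have : DiscreteTopology ι := ⟨rfl⟩
  refine ⟨Set.range (codingMap q e), Set.range_nonempty _,
    isCompact_range (continuous_codingMap e hq hq1), ?_⟩
  ext y
  simp only [Set.mem_iUnion, Set.mem_image, Set.mem_range, exists_exists_eq_and, equiIFS]
  constructor
  · rintro ⟨w, rfl⟩
    exact ⟨w 0, fun i => w (i + 1), (codingMap_eq_shift e hq hq1 w).symm⟩
  · rintro ⟨i, w, rfl⟩
    refine ⟨fun n => Nat.casesOn n i w, ?_⟩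
    rw [codingMap_eq_shift e hq hq1]
    rfl

/-- Each common initial letter scales the distance by q; at the first differing letter the
separation δ of the first-level pieces applies. -/
lemma le_abs_codingMap_sub {K : Set ℝ} (hK : IsClosed K) (hne : K.Nonempty)
    (hinv : ∀ i, ∀ x ∈ K, q * x + e i ∈ K) (hq : 0 < q) (hq1 : q < 1) {δ : ℝ}
    (hsep : ∀ i j, i ≠ j → ∀ x ∈ K, ∀ y ∈ K, δ ≤ |q * x + e i - (q * y + e j)|) (n : ℕ) :
    ∀ w w' : ℕ → ι, (∀ i < n, w i = w' i) → w n ≠ w' n →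
      δ * q ^ n ≤ |codingMap q e w - codingMap q e w'| := by
  induction n with
  | zero =>
    intro w w' _ hne'
    rw [codingMap_eq_shift e hq hq1 w, codingMap_eq_shift e hq hq1 w']
    simpa using hsep _ _ hne' _ (codingMap_mem e hK hne hinv hq hq1 _) _
      (codingMap_mem e hK hne hinv hq hq1 _)
  | succ n ih =>
    intro w w' hag hne'
    rw [codingMap_eq_shift e hq hq1 w, codingMap_eq_shift e hq hq1 w', hag 0 (by omega)]
    have h := ih (fun i => w (i + 1)) (fun i => w' (i + 1)) (fun i hi => hag _ (by omega)) hne'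
    calc δ * q ^ (n + 1) = q * (δ * q ^ n) := by ring
      _ ≤ q * |codingMap q e (fun i => w (i + 1)) - codingMap q e (fun i => w' (i + 1))| := by
        gcongr
      _ = _ := by
        rw [← abs_of_pos hq, ← abs_mul, abs_of_pos hq]; ring_nf

end Coding

/-- If `N` separated maps of ratio `q` send the compact set `K` into itself, then
`N ≤ q ^ (-t)` for every `t` larger than the Hausdorff dimension of `K`. -/
lemma card_le_rpow_of_dimH_lt {N : ℕ} {q : ℝ} (e : Fin N → ℝ) {K : Set ℝ} (hK : IsClosed K)
    (hne : K.Nonempty) (hinv : ∀ i, ∀ x ∈ K, q * x + e i ∈ K) (hq : 0 < q) (hq1 : q < 1) {δ : ℝ}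
    (hδ : 0 < δ)
    (hsep : ∀ i j, i ≠ j → ∀ x ∈ K, ∀ y ∈ K, δ ≤ |q * x + e i - (q * y + e j)|)
    {t : ℝ} (ht : dimH K < ENNReal.ofReal t) : (N : ℝ) ≤ q ^ (-t) := by
  have ht0 : 0 < t := by
    by_contra! h
    simp [ENNReal.ofReal_of_nonpos h] at ht
  have hlogq : Real.log q < 0 := Real.log_neg hq hq1
  rcases Nat.lt_or_ge 1 N with hN | hN
  swap
  · calc (N : ℝ) ≤ 1 := by exact_mod_cast hN
      _ ≤ q ^ (-t) := Real.one_le_rpow_of_pos_of_le_one_of_nonpos hq hq1.le (by linarith)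
  have hN0 : (0 : ℝ) < N := by positivity
  have hlogN : 0 < Real.log N := Real.log_pos (by exact_mod_cast hN)
  -- The similarity dimension of the subsystem, N q^α = 1.
  set α : ℝ := Real.log N / (-Real.log q) with hα
  have hα0 : 0 < α := div_pos hlogN (by linarith)
  have hqα : q ^ α = (N : ℝ)⁻¹ := by
    rw [Real.rpow_def_of_pos hq, hα, div_neg, mul_neg, mul_div_cancel₀ _ hlogq.ne,
      Real.exp_neg, Real.exp_log hN0]
  have hinj : Function.Injective (codingMap q e) := by
    intro w w' h
    by_contra hww
    obtain ⟨n, hn⟩ := Function.ne_iff.mp hww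
    have hex : ∃ n, w n ≠ w' n := ⟨n, hn⟩
    classical
    have := le_abs_codingMap_sub e hK hne hinv hq hq1 hsep (Nat.find hex) w w'
      (fun i hi => not_not.mp (Nat.find_min hex hi)) (Nat.find_spec hex)
    rw [h, sub_self, abs_zero] at this
    exact absurd this (not_le.mpr (by positivity))
  have : Nonempty (ℕ → Fin N) := ⟨fun _ => ⟨0, by omega⟩⟩
  -- Addresses are read as base-N expansions. If they first differ at place n, the values differ by
  -- at most N^{-n} = (q^n)^α while the points are at least δ q^n apart. So `f` is α-Hölder, and its
  -- image of the coded set contains [0,1], forcing dim_H K ≥ α.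
  let f : ℝ → ℝ := fun x => Real.ofDigits (Function.invFun (codingMap q e) x)
  have hf : ∀ w, f (codingMap q e w) = Real.ofDigits w := fun w => by
    simp only [f, Function.leftInverse_invFun hinj w]
  have hhold : HolderOnWith (Real.toNNReal (δ⁻¹ ^ α)) (Real.toNNReal α) f
      (Set.range (codingMap q e)) := by
    rintro _ ⟨w, rfl⟩ _ ⟨w', rfl⟩
    rw [hf, hf, edist_dist, edist_dist, Real.coe_toNNReal _ hα0.le,
      ENNReal.ofReal_rpow_of_nonneg dist_nonneg hα0.le]
    change _ ≤ ENNReal.ofReal (δ⁻¹ ^ α) * _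
    rw [← ENNReal.ofReal_mul (by positivity)]
    apply ENNReal.ofReal_le_ofReal
    by_cases hww : w = w'
    · subst hww; simp only [dist_self]; positivity
    obtain ⟨n, hn⟩ := Function.ne_iff.mp hww
    have hex : ∃ n, w n ≠ w' n := ⟨n, hn⟩
    classical
    have hag : ∀ i < Nat.find hex, w i = w' i := fun i hi => not_not.mp (Nat.find_min hex hi)
    have h1 := le_abs_codingMap_sub e hK hne hinv hq hq1 hsep (Nat.find hex) w w' hag
      (Nat.find_spec hex)
    have h2 := Real.abs_ofDigits_sub_ofDigits_le hag
    rw [Real.dist_eq, Real.dist_eq]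
    refine h2.trans ?_
    rw [← Real.mul_rpow (by positivity) (abs_nonneg _)]
    calc ((N : ℝ) ^ Nat.find hex)⁻¹ = (q ^ Nat.find hex) ^ α := by
          rw [← Real.rpow_natCast q, ← Real.rpow_mul hq.le, mul_comm, Real.rpow_mul hq.le, hqα,
            Real.rpow_natCast, inv_pow]
      _ ≤ _ := by
          apply Real.rpow_le_rpow (by positivity) _ hα0.le
          rw [inv_mul_eq_div, le_div_iff₀ hδ]; linarith
  have himg : Set.Icc (0 : ℝ) 1 ⊆ f '' Set.range (codingMap q e) := by
    intro y hy
    obtain ⟨w, -, rfl⟩ := Real.ofDigits_SurjOn hN hy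
    exact ⟨_, ⟨w, rfl⟩, hf w⟩
  have h1 : (1 : ℝ≥0∞) ≤ dimH K / ENNReal.ofReal α := by
    calc (1 : ℝ≥0∞) = dimH (Set.Icc (0 : ℝ) 1) := by
          rw [Real.dimH_of_nonempty_interior (by simp)]; simp
      _ ≤ dimH (f '' Set.range (codingMap q e)) := dimH_mono himg
      _ ≤ dimH (Set.range (codingMap q e)) / ENNReal.ofReal α :=
          hhold.dimH_image_le (by simpa using hα0)
      _ ≤ dimH K / ENNReal.ofReal α := by
          gcongr
          exact Set.range_subset_iff.mpr fun w => codingMap_mem e hK hne hinv hq hq1 w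
  rw [ENNReal.le_div_iff_mul_le (Or.inl (by simpa using hα0)) (Or.inl ENNReal.ofReal_ne_top),
    one_mul] at h1
  have hαt : α < t := (ENNReal.ofReal_lt_ofReal_iff ht0).mp (h1.trans_lt ht)
  have : (N : ℝ) = q ^ (-α) := by rw [Real.rpow_neg hq.le, hqα, inv_inv]
  rw [this]
  exact Real.rpow_le_rpow_of_exponent_ge hq hq1.le (by linarith)

/-! ### Covering numbers -/

lemma openCoveringNumber_le_ofReal {X : Type*} [PseudoMetricSpace X] {F E : Set X} {r a : ℝ}
    {T : Finset X} (hTF : (T : Set X) ⊆ F) (hT : E ⊆ ⋃ y ∈ T, Metric.ball y r)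
    (ha : (T.card : ℝ) ≤ a) : (openCoveringNumber F E r : ℝ≥0∞) ≤ ENNReal.ofReal a := by
  calc (openCoveringNumber F E r : ℝ≥0∞) ≤ ((T.card : ℕ∞) : ℝ≥0∞) :=
        ENat.toENNReal_le.mpr (iInf₂_le_of_le T hTF (iInf_le _ hT))
    _ = ENNReal.ofReal T.card := by simp
    _ ≤ _ := ENNReal.ofReal_le_ofReal ha

lemma exists_cover_of_openCoveringNumber_le {X : Type*} [PseudoMetricSpace X] {F E : Set X}
    {r a : ℝ} (ha : 0 ≤ a) (h : (openCoveringNumber F E r : ℝ≥0∞) ≤ ENNReal.ofReal a) :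
    ∃ T : Finset X, (T : Set X) ⊆ F ∧ E ⊆ ⋃ y ∈ T, Metric.ball y r ∧ (T.card : ℝ) ≤ a := by
  -- The infimum in `ℕ∞` is attained when finite: some cover has cardinality below the value plus
  -- one.
  have hfin : openCoveringNumber F E r < openCoveringNumber F E r + 1 := by
    rw [ENat.lt_add_one_iff]
    rw [← ENat.toENNReal_ne_top]
    exact (h.trans_lt ENNReal.ofReal_lt_top).ne
  conv_lhs at hfin => rw [openCoveringNumber]
  simp only [iInf_lt_iff] at hfin
  obtain ⟨T, hTF, hT, hlt⟩ := hfin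
  refine ⟨T, hTF, hT, ?_⟩
  have h1 : (T.card : ℕ∞) ≤ openCoveringNumber F E r := (ENat.lt_add_one_iff' (ENat.natCast_ne_top _)).mp hlt
  have h2 : (T.card : ℝ≥0∞) ≤ ENNReal.ofReal a := by
    have := (ENat.toENNReal_le.mpr h1).trans h
    simpa using this
  rw [← ENNReal.ofReal_natCast] at h2
  exact (ENNReal.ofReal_le_ofReal_iff ha).mp h2

/-- A maximal ρ/2-separated subset covers at radius ρ/2 by maximality. It is finite because a
compact set has a finite ρ/4-cover. -/
lemma exists_finset_separated_cover {K : Set ℝ} (hK : IsCompact K) {ρ : ℝ} (hρ : 0 < ρ) :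
    ∃ T : Finset ℝ, (T : Set ℝ) ⊆ K ∧ (∀ x ∈ T, ∀ y ∈ T, x ≠ y → ρ / 2 < dist x y) ∧
      K ⊆ ⋃ y ∈ T, Metric.ball y ρ := by
  obtain ⟨ε, hε⟩ : ∃ ε : NNReal, (ε : ℝ) = ρ / 4 := ⟨⟨ρ / 4, by positivity⟩, rfl⟩
  have hε0 : ε ≠ 0 := by
    rintro rfl
    simp at hε
    linarith
  obtain ⟨N, -, hNfin, hN⟩ := Metric.exists_finite_isCover_of_isCompact hε0 hK
  have hpack : Metric.packingNumber (2 * ε) K ≠ ⊤ :=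
    ne_top_of_le_ne_top hNfin.encard_lt_top.ne
      ((Metric.packingNumber_two_mul_le_externalCoveringNumber ε K).trans
        hN.externalCoveringNumber_le_encard)
  have hfin : (Metric.maximalSeparatedSet (2 * ε) K).Finite := by
    rw [← Set.encard_ne_top_iff, Metric.encard_maximalSeparatedSet hpack]
    exact hpack
  have h2 : ((2 * ε : NNReal) : ℝ) = ρ / 2 := by push_cast; rw [hε]; ring
  refine ⟨hfin.toFinset, by simpa using Metric.maximalSeparatedSet_subset, ?_, ?_⟩
  · intro x hx y hy hxy
    have := Metric.isSeparated_maximalSeparatedSet (hfin.mem_toFinset.mp hx)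
      (hfin.mem_toFinset.mp hy) hxy
    rw [← h2, dist_nndist, NNReal.coe_lt_coe, ← ENNReal.coe_lt_coe, ← edist_nndist]
    exact this
  · intro x hx
    obtain ⟨y, hy, hxy⟩ := Metric.isCover_maximalSeparatedSet hpack hx
    simp only [Set.mem_iUnion]
    refine ⟨y, hfin.mem_toFinset.mpr hy, ?_⟩
    have hxy' : edist x y ≤ ((2 * ε : NNReal) : ℝ≥0∞) := hxy
    rw [edist_nndist, ENNReal.coe_le_coe, ← NNReal.coe_le_coe, ← dist_nndist, h2] at hxy'
    rw [Metric.mem_ball]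
    linarith

/-- A set with efficient covers at a sequence of scales tending to `0` has small Hausdorff
dimension. -/
lemma dimH_le_of_covers {K : Set ℝ} {s C : ℝ} (hs : 0 ≤ s)
    (h : ∀ ε > 0, ∃ η, 0 < η ∧ η < ε ∧ ∃ T : Finset ℝ, K ⊆ ⋃ y ∈ T, Metric.ball y η ∧
      (T.card : ℝ) ≤ C * η ^ (-s)) : dimH K ≤ ENNReal.ofReal s := by
  choose η hη0 hη T hT hcard using fun n : ℕ => h (1 / ((n : ℝ) + 1)) (by positivity)
  apply dimH_le_of_hausdorffMeasure_ne_top (d := s.toNNReal)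
  rw [Real.coe_toNNReal _ hs]
  have hdiam : ∀ n (y : T n), Metric.ediam (Metric.ball (y : ℝ) (η n)) ≤
      ENNReal.ofReal (2 * η n) := by
    intro n y
    rw [← Metric.eball_ofReal, ENNReal.ofReal_mul (by norm_num)]
    exact Metric.ediam_eball_le.trans (by simp)
  have hlim : Filter.Tendsto (fun n => ENNReal.ofReal (2 * η n)) Filter.atTop (𝓝 0) := by
    rw [← ENNReal.ofReal_zero]
    apply ENNReal.tendsto_ofReal
    have := (squeeze_zero (fun n => (hη0 n).le) (fun n => (hη n).le)
      tendsto_one_div_add_atTop_nhds_zero_nat).const_mul 2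
    simpa using this
  refine ne_top_of_le_ne_top (ENNReal.ofReal_ne_top (r := C * 2 ^ s)) <|
    (MeasureTheory.Measure.hausdorffMeasure_le_liminf_sum s K _ hlim
      (fun n (y : T n) => Metric.ball (y : ℝ) (η n))
      (Filter.Eventually.of_forall hdiam) (Filter.Eventually.of_forall fun n => ?_)).trans ?_
  · refine (hT n).trans fun x hx => ?_
    simp only [Set.mem_iUnion] at hx ⊢
    obtain ⟨y, hy, hxy⟩ := hx
    exact ⟨⟨y, hy⟩, hxy⟩
  · refine Filter.liminf_le_of_frequently_le' (Filter.Frequently.of_forall fun n => ?_)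
    calc ∑ y : T n, Metric.ediam (Metric.ball (y : ℝ) (η n)) ^ s
        ≤ ∑ _y : T n, ENNReal.ofReal ((2 * η n) ^ s) := by
          refine Finset.sum_le_sum fun y _ => ?_
          rw [← ENNReal.ofReal_rpow_of_nonneg (by have := hη0 n; positivity) hs]
          exact ENNReal.rpow_le_rpow (hdiam n y) hs
      _ = ENNReal.ofReal ((T n).card * (2 * η n) ^ s) := by
          rw [ENNReal.ofReal_mul (by positivity)]
          simp
      _ ≤ ENNReal.ofReal (C * 2 ^ s) := by
          apply ENNReal.ofReal_le_ofReal
          have hpos : 0 < η n ^ s := Real.rpow_pos_of_pos (hη0 n) s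
          calc ((T n).card : ℝ) * (2 * η n) ^ s ≤ (C * η n ^ (-s)) * (2 * η n) ^ s := by
                gcongr
                · exact Real.rpow_nonneg (by have := hη0 n; positivity) s
                · exact hcard n
            _ = C * 2 ^ s := by
                rw [Real.mul_rpow (by norm_num) (hη0 n).le, Real.rpow_neg (hη0 n).le]
                field_simp

/-! ### Words in an equicontractive system -/

section Words

variable {ι : Type*} {r : ℝ} {d : ι → ℝ} {K : Set ℝ}

lemma wordMap_equiIFS (w : List ι) (x : ℝ) :
    wordMap (equiIFS r d) w x = r ^ w.length * x + wordMap (equiIFS r d) w 0 := by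
  induction w with
  | nil => simp [wordMap]
  | cons i w ih =>
    simp only [wordMap, Function.comp, equiIFS, List.length_cons] at ih ⊢
    rw [ih]; ring

lemma abs_wordMap_sub (hr : 0 < r) (w : List ι) (x y : ℝ) :
    |wordMap (equiIFS r d) w x - wordMap (equiIFS r d) w y| = r ^ w.length * |x - y| := by
  rw [wordMap_equiIFS w x, wordMap_equiIFS w y, add_sub_add_right_eq_sub, ← mul_sub, abs_mul,
    abs_of_pos (pow_pos hr _)]

lemma IsAttractor.map_mem {S : ι → ℝ → ℝ} (h : IsAttractor S K) (i : ι) {x : ℝ} (hx : x ∈ K) :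
    S i x ∈ K := by
  rw [h.eq_iUnion]
  exact Set.mem_iUnion.mpr ⟨i, x, hx, rfl⟩

lemma IsAttractor.wordMap_mem {S : ι → ℝ → ℝ} (h : IsAttractor S K) (w : List ι) {x : ℝ}
    (hx : x ∈ K) : wordMap S w x ∈ K := by
  induction w with
  | nil => exact hx
  | cons i w ih => exact h.map_mem i ih

lemma IsAttractor.exists_wordMap_eq {S : ι → ℝ → ℝ} (h : IsAttractor S K) (n : ℕ) :
    ∀ {y : ℝ}, y ∈ K → ∃ w : List ι, w.length = n ∧ ∃ x ∈ K, wordMap S w x = y := by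
  induction n with
  | zero => intro y hy; exact ⟨[], rfl, y, hy, rfl⟩
  | succ n ih =>
    intro y hy
    rw [h.eq_iUnion] at hy
    obtain ⟨i, z, hz, rfl⟩ := Set.mem_iUnion.mp hy
    obtain ⟨w, hw, x, hx, rfl⟩ := ih hz
    exact ⟨i :: w, by simp [hw], x, hx, rfl⟩

lemma IsAttractor.exists_dist_bound {S : ι → ℝ → ℝ} (h : IsAttractor S K) :
    ∃ D : ℝ, 1 ≤ D ∧ ∀ x ∈ K, ∀ y ∈ K, |x - y| ≤ D := by
  refine ⟨max 1 (Metric.diam K), le_max_left _ _, fun x hx y hy => ?_⟩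
  exact (Metric.dist_le_diam_of_mem h.isCompact.isBounded hx hy).trans (le_max_right _ _)

/-- Above the Hausdorff dimension, self-similar sets have uniformly efficient covers. -/
lemma IsAttractor.exists_covers_of_dimH_lt (h : IsAttractor (equiIFS r d) K) (hr : 0 < r)
    (hr1 : r < 1) {t : ℝ} (ht : dimH K < ENNReal.ofReal t) :
    ∃ C : ℝ, 0 < C ∧ ∀ ρ : ℝ, 0 < ρ → ρ ≤ 1 → ∃ T : Finset ℝ, (T : Set ℝ) ⊆ K ∧
      K ⊆ ⋃ y ∈ T, Metric.ball y ρ ∧ (T.card : ℝ) ≤ C * ρ ^ (-t) := by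
  have ht0 : 0 < t := by
    by_contra! h
    simp [ENNReal.ofReal_of_nonpos h] at ht
  obtain ⟨D, hD1, hD⟩ := h.exists_dist_bound
  have hD0 : 0 < D := by linarith
  refine ⟨(r / (8 * D)) ^ (-t), by positivity, fun ρ hρ hρ1 => ?_⟩
  obtain ⟨T, hTK, hTsep, hTcov⟩ := exists_finset_separated_cover h.isCompact hρ
  refine ⟨T, hTK, hTcov, ?_⟩
  -- Level k+1 cylinders have diameter below ρ/8 but comparable to ρ. Cylinders through points of
  -- `T` stay ρ/2 - 2·ρ/8 = ρ/4 apart, so they form a separated subsystem.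
  obtain ⟨k, hk1, hk2⟩ := exists_nat_pow_near_of_lt_one (x := ρ / (8 * D)) (by positivity)
    (by rw [div_le_one (by positivity)]; linarith) hr hr1
  have hkD : r ^ (k + 1) * D < ρ / 8 := by
    calc r ^ (k + 1) * D < ρ / (8 * D) * D := by gcongr
      _ = ρ / 8 := by field_simp
  choose w hw x hx hwx using fun y : T => h.exists_wordMap_eq (k + 1) (hTK y.2)
  let σ : Fin T.card ≃ T := T.equivFin.symm
  have key := card_le_rpow_of_dimH_lt (q := r ^ (k + 1)) (δ := ρ / 4)
    (fun i => wordMap (equiIFS r d) (w (σ i)) 0) h.isCompact.isClosed h.nonempty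
    (fun i y hy => by
      have := h.wordMap_mem (w (σ i)) hy
      rwa [wordMap_equiIFS, hw] at this)
    (pow_pos hr _) (pow_lt_one₀ hr.le hr1 (by omega)) (by positivity)
    (fun i j hij y hy z hz => by
      have e1 := wordMap_equiIFS (r := r) (d := d) (w (σ i)) y
      have e2 := wordMap_equiIFS (r := r) (d := d) (w (σ j)) z
      rw [hw] at e1 e2
      rw [← e1, ← e2]
      have hne : ((σ i : T) : ℝ) ≠ (σ j : T) := fun h => hij (σ.injective (Subtype.ext h))
      have b0 := hTsep _ (σ i).2 _ (σ j).2 hne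
      have b1 := abs_wordMap_sub (d := d) hr (w (σ i)) (x (σ i)) y
      have b2 := abs_wordMap_sub (d := d) hr (w (σ j)) (x (σ j)) z
      rw [hwx, hw] at b1 b2
      have c1 := mul_le_mul_of_nonneg_left (hD _ (hx (σ i)) _ hy) (pow_pos hr (k + 1)).le
      have c2 := mul_le_mul_of_nonneg_left (hD _ (hx (σ j)) _ hz) (pow_pos hr (k + 1)).le
      rw [Real.dist_eq] at b0
      have a1 := abs_sub_le ((σ i : T) : ℝ) (wordMap (equiIFS r d) (w (σ i)) y) (σ j : T)
      have a2 := abs_sub_le (wordMap (equiIFS r d) (w (σ i)) y)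
        (wordMap (equiIFS r d) (w (σ j)) z) (σ j : T)
      rw [abs_sub_comm (wordMap (equiIFS r d) (w (σ j)) z)] at a2
      linarith) ht
  refine key.trans ?_
  rw [← Real.mul_rpow (by positivity) hρ.le]
  apply Real.rpow_le_rpow_of_nonpos (by positivity) _ (by linarith)
  calc r / (8 * D) * ρ = r * (ρ / (8 * D)) := by ring
    _ ≤ r * r ^ k := by gcongr
    _ = r ^ (k + 1) := by ring

end Words

/-! ### Dimension functions -/

lemma rpow_one_add_eq {R : ℝ} (hR : 0 < R) (a : ℝ) :
    R ^ (1 + a) = R * Real.exp (-(a * Real.log (1 / R))) := by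
  rw [Real.rpow_add hR, Real.rpow_one, Real.rpow_def_of_pos hR, one_div, Real.log_inv]
  ring_nf

lemma rpow_neg_mul_eq {R : ℝ} (hR : 0 < R) (a s : ℝ) :
    R ^ (-a * s) = Real.exp (a * Real.log (1 / R) * s) := by
  rw [Real.rpow_def_of_pos hR, one_div, Real.log_inv]
  ring_nf

lemma IsDimensionFunction.gap_pos {φ : ℝ → ℝ} (hφ : IsDimensionFunction φ) {R : ℝ} (hR : 0 < R)
    (hR1 : R < 1) : 0 < φ R * Real.log (1 / R) :=
  mul_pos (hφ.pos R ⟨hR, hR1⟩) (Real.log_pos ((one_lt_div hR).mpr hR1))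

lemma IsDimensionFunction.eventually_lt_gap {φ : ℝ → ℝ} (hφ : IsDimensionFunction φ) (M : ℝ) :
    ∀ᶠ R in 𝓝[>] (0 : ℝ), M < φ R * Real.log (1 / R) :=
  hφ.gap_tendsto.eventually_gt_atTop M

/-- Exponents admissible for the `φ`-Assouad dimension of a non-empty set are non-negative. -/
lemma IsDimensionFunction.nonneg_of_cover {φ : ℝ → ℝ} (hφ : IsDimensionFunction φ) {F : Set ℝ}
    (hF : F.Nonempty) {s C : ℝ} (hC : 0 < C)
    (h : ∀ R : ℝ, 0 < R → R < 1 → ∀ x ∈ F,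
      (openCoveringNumber F (F ∩ Metric.ball x R) (R ^ (1 + φ R)) : ℝ≥0∞)
        ≤ ENNReal.ofReal (C * R ^ (-φ R * s))) : 0 ≤ s := by
  by_contra! hs
  obtain ⟨x, hx⟩ := hF
  -- For s < 0 the bound C e^{Gs} drops below 1 once G is large, yet a non-empty set needs at least
  -- one ball.
  obtain ⟨R, hgap, hR, hR1⟩ := ((hφ.eventually_lt_gap (Real.log C / (-s))).and
    (Ioo_mem_nhdsGT (zero_lt_one (α := ℝ)))).exists
  obtain ⟨T, -, hT, hcard⟩ := exists_cover_of_openCoveringNumber_le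
    (by positivity) (h R hR hR1 x hx)
  have hTne : 0 < T.card := by
    have := hT ⟨hx, Metric.mem_ball_self hR⟩
    simp only [Set.mem_iUnion] at this
    obtain ⟨y, hy, -⟩ := this
    exact Finset.card_pos.mpr ⟨y, hy⟩
  have h1 : (1 : ℝ) ≤ T.card := by exact_mod_cast hTne
  rw [rpow_neg_mul_eq hR] at hcard
  rw [div_lt_iff₀ (by linarith)] at hgap
  have h2 : C * Real.exp (φ R * Real.log (1 / R) * s) < 1 := by
    rw [← Real.exp_log hC, ← Real.exp_add, Real.exp_lt_one_iff]
    linarith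
  linarith

/-! ### The `φ`-Assouad dimension of a self-similar set -/

section SelfSimilar

variable {ι : Type*} {r : ℝ} {d : ι → ℝ} {K : Set ℝ} {φ : ℝ → ℝ}

/-- Admissible exponents of a self-similar set are at least its Hausdorff dimension. -/
lemma IsAttractor.dimH_le_of_cover (h : IsAttractor (equiIFS r d) K) (hr : 0 < r) (hr1 : r < 1)
    (hφ : IsDimensionFunction φ) {s C : ℝ} (hC : 0 < C)
    (hcov : ∀ R : ℝ, 0 < R → R < 1 → ∀ x ∈ K,
      (openCoveringNumber K (K ∩ Metric.ball x R) (R ^ (1 + φ R)) : ℝ≥0∞)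
        ≤ ENNReal.ofReal (C * R ^ (-φ R * s))) : dimH K ≤ ENNReal.ofReal s := by
  have hs : 0 ≤ s := hφ.nonneg_of_cover h.nonempty hC hcov
  obtain ⟨D, hD1, hD⟩ := h.exists_dist_bound
  have hD0 : 0 < D := by linarith
  obtain ⟨x, hx⟩ := h.nonempty
  set A : ℝ := D / r with hA
  have hA0 : 0 < A := by positivity
  refine dimH_le_of_covers (C := C * A ^ s) hs fun ε hε => ?_
  obtain ⟨R, hgap, hR, hR1⟩ := ((hφ.eventually_lt_gap (Real.log (A / ε))).and
    (Ioo_mem_nhdsGT (zero_lt_one (α := ℝ)))).exists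
  set G := φ R * Real.log (1 / R) with hG
  obtain ⟨T, -, hT, hcard⟩ := exists_cover_of_openCoveringNumber_le
    (by positivity) (hcov R hR hR1 x hx)
  rw [rpow_neg_mul_eq hR, ← hG] at hcard
  rw [rpow_one_add_eq hR, ← hG] at hT
  -- The level k+1 cylinder through x lies inside B(x,R), while R ≤ A r^{k+1}.
  obtain ⟨k, hk1, hk2⟩ := exists_nat_pow_near_of_lt_one (x := R / D) (by positivity)
    (by rw [div_le_one hD0]; linarith) hr hr1
  obtain ⟨w, hw, z, hz, hwz⟩ := h.exists_wordMap_eq (k + 1) hx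
  have hpos := pow_pos hr (k + 1)
  have hkR : R ≤ A * r ^ (k + 1) := by
    rw [div_le_iff₀ hD0] at hk2
    calc R ≤ r ^ k * D := hk2
      _ = A * r ^ (k + 1) := by rw [hA, pow_succ]; field_simp
  -- The cover is pulled back along the cylinder map. The new centres may leave K, which Hausdorff
  -- measure does not mind.
  refine ⟨A * Real.exp (-G), by positivity, ?_, T.image fun y =>
    (y - wordMap (equiIFS r d) w 0) / r ^ (k + 1), fun y hy => ?_, ?_⟩
  · have := Real.exp_lt_exp.mpr (neg_lt_neg hgap)
    rw [Real.exp_neg (Real.log _), Real.exp_log (div_pos hA0 hε), inv_div] at this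
    rwa [lt_div_iff₀ hA0, mul_comm] at this
  · have hyK := h.wordMap_mem w hy
    have hyB : wordMap (equiIFS r d) w y ∈ Metric.ball x R := by
      rw [Metric.mem_ball, Real.dist_eq, ← hwz, abs_wordMap_sub hr, hw]
      calc r ^ (k + 1) * |y - z| ≤ r ^ (k + 1) * D := by gcongr; exact hD _ hy _ hz
        _ < R / D * D := by gcongr
        _ = R := by field_simp
    have := hT ⟨hyK, hyB⟩
    simp only [Set.mem_iUnion] at this ⊢
    obtain ⟨u, hu, hyu⟩ := this
    refine ⟨_, Finset.mem_image_of_mem _ hu, ?_⟩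
    rw [Metric.mem_ball, Real.dist_eq] at hyu ⊢
    rw [wordMap_equiIFS, hw] at hyu
    have e : y - (u - wordMap (equiIFS r d) w 0) / r ^ (k + 1) =
        (r ^ (k + 1) * y + wordMap (equiIFS r d) w 0 - u) / r ^ (k + 1) := by
      field_simp; ring
    rw [e, abs_div, abs_of_pos hpos, div_lt_iff₀ hpos]
    calc _ < R * Real.exp (-G) := hyu
      _ ≤ A * r ^ (k + 1) * Real.exp (-G) := by gcongr
      _ = _ := by ring
  · calc ((T.image _).card : ℝ) ≤ T.card := by exact_mod_cast Finset.card_image_le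
      _ ≤ C * Real.exp (G * s) := hcard
      _ = C * A ^ s * (A * Real.exp (-G)) ^ (-s) := by
        rw [Real.mul_rpow hA0.le (Real.exp_pos _).le, ← Real.exp_mul, Real.rpow_neg hA0.le]
        have := Real.rpow_pos_of_pos hA0 s
        field_simp

lemma finite_cylinderMaps [Finite ι] (n : ℕ) (x ρ : ℝ) :
    (cylinderMaps (equiIFS r d) K n x ρ).Finite := by
  refine ((List.finite_length_eq ι n).image (wordMap (equiIFS r d))).subset ?_
  rintro g ⟨w, hw, rfl, -⟩
  exact ⟨w, hw, rfl⟩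

lemma ncard_cylinderMaps_le [Finite ι] (n : ℕ) {x : ℝ} (hx : x ∈ K) :
    (cylinderMaps (equiIFS r d) K n x (r ^ n)).ncard ≤ overlapCount r d K n := by
  -- A supremum in ℕ over an unbounded family is 0, so boundedness has to be proved first.
  have hbdd : BddAbove (Set.range fun x : K =>
      (cylinderMaps (equiIFS r d) K n x (r ^ n)).ncard) := by
    refine ⟨((wordMap (equiIFS r d)) '' {w : List ι | w.length = n}).ncard, ?_⟩
    rintro _ ⟨x, rfl⟩
    refine Set.ncard_le_ncard ?_ ((List.finite_length_eq ι n).image _)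
    rintro g ⟨w, hw, rfl, -⟩
    exact ⟨w, hw, rfl⟩
  exact le_ciSup hbdd ⟨x, hx⟩

/-- A quantitative form of the condition on the overlap counts. -/
lemma exists_overlapCount_le (hr : 0 < r) (hr1 : r < 1) (hφ : IsDimensionFunction φ)
    (hlim : Filter.Tendsto
        (fun n : ℕ => Real.log (overlapCount r d K n : ℝ) / ((n : ℝ) * φ (r ^ n)))
        Filter.atTop (𝓝 0)) {ε : ℝ} (hε : 0 < ε) :
    ∃ C : ℝ, 0 < C ∧ ∀ (n : ℕ) (R : ℝ), 0 < R → R < 1 → R ≤ r ^ n →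
      (overlapCount r d K n : ℝ) ≤ C * Real.exp (ε * (φ R * Real.log (1 / R))) := by
  have hlogr : 0 < Real.log (1 / r) := Real.log_pos ((one_lt_div hr).mpr hr1)
  -- The factor log(1/r) turns n φ(r^n) into the gap at r^n, which is at most the gap at R ≤ r^n.
  -- The finitely many n ≤ n₀ go into the constant.
  obtain ⟨n₀, hn₀⟩ := Filter.eventually_atTop.mp
    (hlim.eventually (gt_mem_nhds (mul_pos hε hlogr)))
  refine ⟨1 + ∑ i ∈ Finset.range (n₀ + 1), (overlapCount r d K i : ℝ), by positivity,
    fun n R hR hR1 hRn => ?_⟩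
  have hgap := hφ.gap_pos hR hR1
  have hexp : 1 ≤ Real.exp (ε * (φ R * Real.log (1 / R))) := Real.one_le_exp (by positivity)
  have hsum : 0 ≤ ∑ i ∈ Finset.range (n₀ + 1), (overlapCount r d K i : ℝ) := by positivity
  rcases Nat.lt_or_ge n₀ n with hn | hn
  · have hnpos : (0 : ℝ) < n := by exact_mod_cast (by omega : 0 < n)
    have hrn : r ^ n ∈ Set.Ioo (0 : ℝ) 1 := ⟨pow_pos hr n, pow_lt_one₀ hr.le hr1 (by omega)⟩
    have h1 := hn₀ n hn.le
    have hden := mul_pos hnpos (hφ.pos _ hrn)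
    rw [div_lt_iff₀ hden] at h1
    have h2 : φ (r ^ n) * Real.log (1 / r ^ n) ≤ φ R * Real.log (1 / R) :=
      hφ.gap_antitone ⟨hR, hR1⟩ hrn hRn
    have h3 : Real.log (1 / r ^ n) = n * Real.log (1 / r) := by
      rw [← one_div_pow, Real.log_pow]
    rw [h3] at h2
    have h4 : Real.log (overlapCount r d K n) ≤ ε * (φ R * Real.log (1 / R)) := by
      refine h1.le.trans ?_
      calc ε * Real.log (1 / r) * (n * φ (r ^ n))
          = ε * (φ (r ^ n) * (n * Real.log (1 / r))) := by ring
        _ ≤ _ := by gcongr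
    calc (overlapCount r d K n : ℝ) ≤ Real.exp (Real.log (overlapCount r d K n)) :=
          Real.le_exp_log _
      _ ≤ 1 * Real.exp (ε * (φ R * Real.log (1 / R))) := by
          rw [one_mul]; exact Real.exp_le_exp.mpr h4
      _ ≤ _ := by gcongr; linarith
  · calc (overlapCount r d K n : ℝ)
        ≤ ∑ i ∈ Finset.range (n₀ + 1), (overlapCount r d K i : ℝ) :=
          Finset.single_le_sum (f := fun i => (overlapCount r d K i : ℝ))
            (fun i _ => by positivity) (Finset.mem_range.mpr (by omega))
      _ ≤ (1 + ∑ i ∈ Finset.range (n₀ + 1), (overlapCount r d K i : ℝ)) * 1 := by linarith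
      _ ≤ _ := by gcongr

/-- Under the overlap condition every exponent above the Hausdorff dimension is admissible. -/
lemma IsAttractor.exists_cover_of_dimH_lt [Finite ι] (h : IsAttractor (equiIFS r d) K)
    (hr : 0 < r) (hr1 : r < 1) (hφ : IsDimensionFunction φ)
    (hlim : Filter.Tendsto
        (fun n : ℕ => Real.log (overlapCount r d K n : ℝ) / ((n : ℝ) * φ (r ^ n)))
        Filter.atTop (𝓝 0)) {s t : ℝ} (ht : dimH K < ENNReal.ofReal t) (hts : t < s) :
    ∃ C : ℝ, 0 < C ∧ ∀ R : ℝ, 0 < R → R < 1 → ∀ x ∈ K,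
      (openCoveringNumber K (K ∩ Metric.ball x R) (R ^ (1 + φ R)) : ℝ≥0∞)
        ≤ ENNReal.ofReal (C * R ^ (-φ R * s)) := by
  have ht0 : 0 < t := by
    by_contra! h
    simp [ENNReal.ofReal_of_nonpos h] at ht
  -- The exponent s is split: s - t pays for the overlaps, t for the cover inside one cylinder.
  obtain ⟨C₁, hC₁, hover⟩ := exists_overlapCount_le hr hr1 hφ hlim (sub_pos.mpr hts)
  obtain ⟨C₂, hC₂, hbox⟩ := h.exists_covers_of_dimH_lt hr hr1 ht
  refine ⟨C₁ * (C₂ * r ^ (-t)), by positivity, fun R hR hR1 x hx => ?_⟩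
  obtain ⟨n, hn1, hn2⟩ := exists_nat_pow_near_of_lt_one hR hR1.le hr hr1
  rw [rpow_neg_mul_eq hR, rpow_one_add_eq hR]
  have hgap := hφ.gap_pos hR hR1
  have hover' := hover n R hR hR1 hn2
  set G := φ R * Real.log (1 / R) with hG
  have hpos := pow_pos hr n
  obtain ⟨T, hTK, hTcov, hTcard⟩ := hbox (R * Real.exp (-G) / r ^ n) (by positivity) (by
    rw [div_le_one hpos]
    calc R * Real.exp (-G) ≤ r ^ n * 1 := by
          gcongr
          exact Real.exp_le_one_iff.mpr (by linarith)
      _ = r ^ n := mul_one _)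
  have hfin := finite_cylinderMaps (r := r) (d := d) (K := K) n x (r ^ n)
  classical
  have hmem : ∀ g ∈ hfin.toFinset, ∃ w : List ι, w.length = n ∧ g = wordMap (equiIFS r d) w := by
    intro g hg
    obtain ⟨w, hw, hgw, -⟩ := hfin.mem_toFinset.mp hg
    exact ⟨w, hw, hgw⟩
  -- One rescaled cover of K is copied into every distinct cylinder meeting B(x, r^n).
  refine openCoveringNumber_le_ofReal
    (T := (hfin.toFinset ×ˢ T).image fun p => p.1 p.2) ?_ ?_ ?_
  · intro y hy
    simp only [Finset.coe_image, Set.mem_image, Finset.mem_coe, Finset.mem_product] at hy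
    obtain ⟨⟨g, u⟩, ⟨hg, hu⟩, rfl⟩ := hy
    obtain ⟨w, -, rfl⟩ := hmem g hg
    exact h.wordMap_mem w (hTK hu)
  · rintro y ⟨hyK, hyB⟩
    obtain ⟨w, hw, z, hz, rfl⟩ := h.exists_wordMap_eq n hyK
    have hzT := hTcov hz
    simp only [Set.mem_iUnion] at hzT ⊢
    obtain ⟨u, hu, hzu⟩ := hzT
    refine ⟨wordMap (equiIFS r d) w u, Finset.mem_image.mpr
      ⟨(wordMap (equiIFS r d) w, u), Finset.mem_product.mpr ⟨hfin.mem_toFinset.mpr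
        ⟨w, hw, rfl, _, ⟨z, hz, rfl⟩, Metric.ball_subset_ball hn2 hyB⟩, hu⟩, rfl⟩, ?_⟩
    rw [Metric.mem_ball, Real.dist_eq] at hzu ⊢
    rw [abs_wordMap_sub hr, hw, mul_comm]
    exact (lt_div_iff₀ hpos).mp hzu
  · have hc1 : (hfin.toFinset.card : ℝ) ≤ C₁ * Real.exp ((s - t) * G) := by
      refine le_trans ?_ hover'
      rw [← Set.ncard_eq_toFinset_card _ hfin]
      exact_mod_cast ncard_cylinderMaps_le n hx
    have hc2 : (T.card : ℝ) ≤ C₂ * r ^ (-t) * Real.exp (G * t) := by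
      refine hTcard.trans ?_
      rw [mul_assoc]
      gcongr
      have e : r ^ (-t) * Real.exp (G * t) = (r * Real.exp (-G)) ^ (-t) := by
        rw [Real.mul_rpow hr.le (Real.exp_pos _).le, ← Real.exp_mul]
        ring_nf
      rw [e]
      apply Real.rpow_le_rpow_of_nonpos (by positivity) _ (by linarith)
      rw [le_div_iff₀ hpos]
      calc r * Real.exp (-G) * r ^ n = r ^ (n + 1) * Real.exp (-G) := by ring
        _ ≤ R * Real.exp (-G) := by gcongr
    calc (((hfin.toFinset ×ˢ T).image _).card : ℝ) ≤ ((hfin.toFinset ×ˢ T).card : ℝ) := by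
          exact_mod_cast Finset.card_image_le
      _ = hfin.toFinset.card * T.card := by rw [Finset.card_product]; push_cast; rfl
      _ ≤ (C₁ * Real.exp ((s - t) * G)) * (C₂ * r ^ (-t) * Real.exp (G * t)) := by gcongr
      _ = C₁ * (C₂ * r ^ (-t)) * (Real.exp ((s - t) * G) * Real.exp (G * t)) := by ring
      _ = _ := by rw [← Real.exp_add]; ring_nf

/-- The `φ`-Assouad dimension of a self-similar set with few overlaps. -/
theorem IsAttractor.phiAssouadDim_eq_dimH [Finite ι] (h : IsAttractor (equiIFS r d) K)
    (hr : 0 < r) (hr1 : r < 1) (hφ : IsDimensionFunction φ)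
    (hlim : Filter.Tendsto
        (fun n : ℕ => Real.log (overlapCount r d K n : ℝ) / ((n : ℝ) * φ (r ^ n)))
        Filter.atTop (𝓝 0)) : phiAssouadDim φ K = (dimH K : EReal) := by
  have hD : dimH K = ENNReal.ofReal (dimH K).toReal :=
    (ENNReal.ofReal_toReal (Real.dimH_ne_top K)).symm
  have hD' : ((dimH K : ℝ≥0∞) : EReal) = ((dimH K).toReal : EReal) := by
    conv_lhs => rw [hD, EReal.coe_ennreal_ofReal, max_eq_left ENNReal.toReal_nonneg]
  rw [hD']
  apply le_antisymm
  · refine EReal.le_of_forall_lt_iff_le.mp fun s hs => ?_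
    have hs' : (dimH K).toReal < s := EReal.coe_lt_coe_iff.mp hs
    obtain ⟨t, ht, hts⟩ := exists_between hs'
    refine iInf₂_le s (h.exists_cover_of_dimH_lt hr hr1 hφ hlim (t := t) ?_ hts)
    rw [hD]
    exact (ENNReal.ofReal_lt_ofReal_iff (ENNReal.toReal_nonneg.trans_lt ht)).mpr ht
  · refine le_iInf₂ fun s hs => ?_
    obtain ⟨C, hC, hcov⟩ := hs
    have h1 := h.dimH_le_of_cover hr hr1 hφ hC hcov
    have h0 := hφ.nonneg_of_cover h.nonempty hC hcov
    exact EReal.coe_le_coe_iff.mpr (ENNReal.toReal_le_of_le_ofReal h0 h1)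

end SelfSimilar

/-! ### The sparse digit places -/

section DigitData

variable {m : ℕ}

lemma div_pow_leastExponent_le (hm : 2 ≤ m) {ρ : ℝ} (hρ : 0 < ρ) :
    (m : ℝ) / (m : ℝ) ^ leastExponent m ρ ≤ ρ := by
  have hm0 : (0 : ℝ) < m := by positivity
  refine Nat.sInf_mem (s := {n : ℕ | (m : ℝ) / (m : ℝ) ^ n ≤ ρ}) ?_
  obtain ⟨n, hn⟩ := exists_pow_lt_of_lt_one (div_pos hρ hm0)
    (inv_lt_one_of_one_lt₀ (by exact_mod_cast hm : (1 : ℝ) < m))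
  refine ⟨n, ?_⟩
  rw [lt_div_iff₀ hm0, inv_pow, mul_comm, ← div_eq_mul_inv] at hn
  exact hn.le

lemma one_le_leastExponent (hm : 2 ≤ m) {ρ : ℝ} (hρ : 0 < ρ) (hρ1 : ρ ≤ 1) :
    1 ≤ leastExponent m ρ := by
  by_contra! h
  have h0 : leastExponent m ρ = 0 := by omega
  have := div_pow_leastExponent_le hm hρ
  rw [h0, pow_zero, div_one] at this
  have : (2 : ℝ) ≤ m := by exact_mod_cast hm
  linarith

lemma mul_pow_leastExponent_lt (hm : 2 ≤ m) {ρ : ℝ} (hρ : 0 < ρ) (hρ1 : ρ ≤ 1) :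
    ρ * (m : ℝ) ^ leastExponent m ρ < (m : ℝ) ^ 2 := by
  have hm0 : (0 : ℝ) < m := by positivity
  obtain ⟨n, hn⟩ := Nat.exists_eq_add_of_le' (one_le_leastExponent hm hρ hρ1)
  have h : n ∉ {n : ℕ | (m : ℝ) / (m : ℝ) ^ n ≤ ρ} :=
    Nat.notMem_of_lt_sInf (show n < leastExponent m ρ by omega)
  simp only [Set.mem_ofPred_eq, not_le] at h
  rw [lt_div_iff₀ (by positivity)] at h
  rw [hn, pow_succ, ← mul_assoc, sq]
  gcongr

/-- The invariant m ≤ ρ_k m^{N_k} < m³ pins N_{k+1} between 2N_k - 1 and 2N_k. It propagates because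
the choice of n_{k+1} puts ρ_k m^{n_{k+1}} in [m, m²) and the factor 1 + m^{-2} lies between 1 and 2
< m. -/
lemma digitData_bounds (hm : 3 ≤ m) (k : ℕ) :
    0 < (digitData m k).2 ∧ (digitData m k).2 ≤ 1 ∧
      (m : ℝ) ≤ (digitData m k).2 * (m : ℝ) ^ (digitData m k).1 ∧
      (digitData m k).2 * (m : ℝ) ^ (digitData m k).1 < (m : ℝ) ^ 3 := by
  have hm3 : (3 : ℝ) ≤ m := by exact_mod_cast hm
  have hm0 : (0 : ℝ) < m := by linarith
  have hsq : 1 + 1 / (m : ℝ) ^ 2 ≤ 2 := by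
    have : 1 / (m : ℝ) ^ 2 ≤ 1 := by
      rw [div_le_one (by positivity)]; exact one_le_pow₀ (by linarith)
    linarith
  induction k with
  | zero =>
    simp only [digitData, pow_one, one_mul, zero_lt_one, le_refl, true_and]
    exact lt_self_pow₀ (by linarith) (by norm_num)
  | succ k ih =>
    obtain ⟨h0, h1, h2, h3⟩ := ih
    have e1 := div_pow_leastExponent_le (by omega : 2 ≤ m) h0
    have e2 := mul_pow_leastExponent_lt (by omega : 2 ≤ m) h0 h1
    rw [div_le_iff₀ (by positivity)] at e1
    have hsq0 : 1 ≤ 1 + 1 / (m : ℝ) ^ 2 := by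
      have : 0 ≤ 1 / (m : ℝ) ^ 2 := by positivity
      linarith
    have e3 : (digitData m (k + 1)).2 * (m : ℝ) ^ (digitData m (k + 1)).1 =
        (1 + 1 / (m : ℝ) ^ 2) *
          ((digitData m k).2 * (m : ℝ) ^ leastExponent m (digitData m k).2) := by
      simp only [digitData, pow_add]
      field_simp
    rw [e3]
    refine ⟨by simp only [digitData]; positivity, ?_, ?_, ?_⟩
    · simp only [digitData]
      have hN : 1 < (digitData m k).2 * (m : ℝ) ^ (digitData m k).1 := by linarith
      rw [div_le_one (by positivity)]
      have hpow : (m : ℝ) ≤ (m : ℝ) ^ (digitData m k).1 := by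
        refine h2.trans ?_
        exact mul_le_of_le_one_left (by positivity) h1
      calc (1 + 1 / (m : ℝ) ^ 2) * (digitData m k).2 ≤ 2 * 1 := by gcongr
        _ ≤ _ := by linarith
    · calc (m : ℝ) ≤ 1 * ((digitData m k).2 * (m : ℝ) ^ leastExponent m (digitData m k).2) := by
            linarith
        _ ≤ _ := by gcongr
    · calc _ < 2 * (m : ℝ) ^ 2 := mul_lt_mul' hsq e2 (by positivity) (by norm_num)
        _ ≤ m * (m : ℝ) ^ 2 := by gcongr; linarith
        _ = _ := by ring

lemma leastExponent_digitData_le (hm : 3 ≤ m) (k : ℕ) :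
    leastExponent m (digitData m k).2 ≤ (digitData m k).1 := by
  refine Nat.sInf_le ?_
  have hm0 : (0 : ℝ) < m := by positivity
  simp only [Set.mem_ofPred_eq]
  rw [div_le_iff₀ (by positivity)]
  exact (digitData_bounds hm k).2.2.1

lemma digitData_le_leastExponent (hm : 3 ≤ m) (k : ℕ) :
    (digitData m k).1 ≤ leastExponent m (digitData m k).2 + 1 := by
  by_contra! h
  obtain ⟨h0, -, -, h3⟩ := digitData_bounds hm k
  have hm1 : (1 : ℝ) ≤ m := by exact_mod_cast (by omega : 1 ≤ m)
  have e1 := div_pow_leastExponent_le (by omega : 2 ≤ m) h0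
  rw [div_le_iff₀ (by positivity)] at e1
  have : (m : ℝ) ^ 3 ≤ (digitData m k).2 * (m : ℝ) ^ (digitData m k).1 := by
    calc (m : ℝ) ^ 3 = m * (m : ℝ) ^ 2 := by ring
      _ ≤ (digitData m k).2 * (m : ℝ) ^ leastExponent m (digitData m k).2 * (m : ℝ) ^ 2 := by
          gcongr
      _ = (digitData m k).2 * (m : ℝ) ^ (leastExponent m (digitData m k).2 + 2) := by ring
      _ ≤ _ := by gcongr; omega
  linarith

lemma digitData_succ_fst (k : ℕ) : (digitData m (k + 1)).1 =
    (digitData m k).1 + leastExponent m (digitData m k).2 := rfl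

lemma digitData_succ_le (hm : 3 ≤ m) (k : ℕ) :
    (digitData m (k + 1)).1 ≤ 2 * (digitData m k).1 := by
  have := leastExponent_digitData_le hm k
  rw [digitData_succ_fst]
  omega

lemma two_mul_digitData_le (hm : 3 ≤ m) (k : ℕ) :
    2 * (digitData m k).1 ≤ (digitData m (k + 1)).1 + 1 := by
  have := digitData_le_leastExponent hm k
  rw [digitData_succ_fst]
  omega

lemma digitData_lt_succ (hm : 3 ≤ m) (k : ℕ) : (digitData m k).1 < (digitData m (k + 1)).1 := by
  have := one_le_leastExponent (by omega : 2 ≤ m) (digitData_bounds hm k).1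
    (digitData_bounds hm k).2.1
  rw [digitData_succ_fst]
  omega

lemma digitData_le_two_pow (hm : 3 ≤ m) (k : ℕ) : (digitData m k).1 ≤ 2 ^ k := by
  induction k with
  | zero => rfl
  | succ k ih =>
    have := digitData_succ_le hm k
    rw [pow_succ]
    omega

/-- The quantity N_k - 1 at least doubles at each step. -/
lemma two_pow_lt_digitData_succ (hm : 3 ≤ m) (k : ℕ) : 2 ^ k < (digitData m (k + 1)).1 := by
  induction k with
  | zero => exact digitData_lt_succ hm 0
  | succ k ih =>
    have := two_mul_digitData_le hm (k + 1)
    rw [pow_succ]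
    omega

lemma digitData_add_le (hm : 3 ≤ m) (k j : ℕ) : (digitData m k).1 + j ≤ (digitData m (k + j)).1 := by
  induction j with
  | zero => exact le_rfl
  | succ j ih =>
    have := digitData_lt_succ hm (k + j)
    rw [← add_assoc, ← add_assoc]
    omega

lemma one_div_pow_digitData_le (hm : 3 ≤ m) (k j : ℕ) :
    1 / (m : ℝ) ^ (digitData m (k + j)).1 ≤
      1 / (m : ℝ) ^ (digitData m k).1 * (1 / 2) ^ j := by
  have hm1 : (2 : ℝ) ≤ m := by exact_mod_cast (by omega : 2 ≤ m)
  rw [one_div_pow, div_mul_div_comm, one_mul, mul_comm]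
  apply one_div_le_one_div_of_le (by positivity)
  calc (2 : ℝ) ^ j * (m : ℝ) ^ (digitData m k).1 ≤ (m : ℝ) ^ j * (m : ℝ) ^ (digitData m k).1 := by
        gcongr
    _ = (m : ℝ) ^ ((digitData m k).1 + j) := by ring
    _ ≤ _ := pow_le_pow_right₀ (by linarith) (digitData_add_le hm k j)

lemma summable_digitData (hm : 3 ≤ m) (k : ℕ) :
    Summable fun j : ℕ => 1 / (m : ℝ) ^ (digitData m (k + j)).1 :=
  Summable.of_nonneg_of_le (fun j => by positivity) (one_div_pow_digitData_le hm k)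
    (summable_geometric_two.mul_left _)

lemma tsum_digitData_le (hm : 3 ≤ m) (k : ℕ) :
    ∑' j : ℕ, 1 / (m : ℝ) ^ (digitData m (k + j)).1 ≤ 2 / (m : ℝ) ^ (digitData m k).1 := by
  calc _ ≤ ∑' j : ℕ, 1 / (m : ℝ) ^ (digitData m k).1 * (1 / 2 : ℝ) ^ j :=
        (summable_digitData hm k).tsum_le_tsum (one_div_pow_digitData_le hm k)
          (summable_geometric_two.mul_left _)
    _ = _ := by rw [tsum_mul_left, tsum_geometric_two]; ring

lemma le_tsum_digitData (hm : 3 ≤ m) (k : ℕ) :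
    1 / (m : ℝ) ^ (digitData m k).1 ≤ ∑' j : ℕ, 1 / (m : ℝ) ^ (digitData m (k + j)).1 :=
  (summable_digitData hm k).le_tsum 0 fun j _ => by positivity

lemma sparseDigitNumber_eq (hm : 3 ≤ m) (k : ℕ) : sparseDigitNumber m =
    ∑ i ∈ Finset.range k, 1 / (m : ℝ) ^ (digitData m i).1 +
      ∑' j : ℕ, 1 / (m : ℝ) ^ (digitData m (k + j)).1 := by
  have h := summable_digitData hm 0
  simp only [zero_add] at h
  rw [sparseDigitNumber, ← h.sum_add_tsum_nat_add k]
  simp only [add_comm]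

lemma sparseDigitNumber_pos (hm : 3 ≤ m) : 0 < sparseDigitNumber m := by
  have h := le_tsum_digitData hm 0
  have hm0 : (0 : ℝ) < m := by positivity
  rw [sparseDigitNumber_eq hm 0, Finset.sum_range_zero, zero_add]
  exact lt_of_lt_of_le (by positivity) h

lemma sparseDigitNumber_lt_one (hm : 3 ≤ m) : sparseDigitNumber m < 1 := by
  have h := tsum_digitData_le hm 0
  have hm3 : (3 : ℝ) ≤ m := by exact_mod_cast hm
  rw [sparseDigitNumber_eq hm 0, Finset.sum_range_zero, zero_add]
  refine h.trans_lt ?_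
  simp only [digitData, pow_one]
  rw [div_lt_one (by linarith)]
  linarith

end DigitData

/-! ### Intervals densely filled by a set -/

/-- Every point of some interval of length `len` lies at most `mesh` to the right of `K`. -/
def FillsInterval (K : Set ℝ) (mesh len : ℝ) : Prop :=
  ∃ a : ℝ, ∀ y ∈ Set.Icc a (a + len), ∃ z ∈ K, z ≤ y ∧ y ≤ z + mesh

section Fills

variable {K : Set ℝ} {mesh len : ℝ}

lemma FillsInterval.mono (h : FillsInterval K mesh len) {len' : ℝ} (hl : len' ≤ len) :
    FillsInterval K mesh len' := by
  obtain ⟨a, ha⟩ := h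
  exact ⟨a, fun y hy => ha y ⟨hy.1, hy.2.trans (by linarith)⟩⟩

/-- Two overlapping similar copies of a filled interval fill a longer interval. -/
lemma FillsInterval.union (h : FillsInterval K mesh len) {s c c' : ℝ} (hs : 0 < s)
    (hc : ∀ x ∈ K, c + s * x ∈ K) (hc' : ∀ x ∈ K, c' + s * x ∈ K)
    (h1 : c' - c ≤ s * len) : FillsInterval K (s * mesh) (s * len + (c' - c)) := by
  obtain ⟨a, ha⟩ := h
  have key : ∀ b : ℝ, (∀ x ∈ K, b + s * x ∈ K) → ∀ y, b + s * a ≤ y → y ≤ b + s * a + s * len →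
      ∃ z ∈ K, z ≤ y ∧ y ≤ z + s * mesh := by
    intro b hb y hy1 hy2
    obtain ⟨z, hz, hz1, hz2⟩ := ha ((y - b) / s) ⟨by rw [le_div_iff₀ hs]; linarith,
      by rw [div_le_iff₀ hs]; linarith⟩
    rw [le_div_iff₀ hs] at hz1
    rw [div_le_iff₀ hs] at hz2
    exact ⟨_, hb z hz, by linarith, by linarith⟩
  refine ⟨c + s * a, fun y hy => ?_⟩
  rcases le_total y (c + s * a + s * len) with hle | hle
  · exact key c hc y hy.1 hle
  · exact key c' hc' y (by linarith) (by linarith [hy.2])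

lemma FillsInterval.scale (h : FillsInterval K mesh len) {s : ℝ} (hs : 0 < s)
    (hs' : ∀ x ∈ K, s * x ∈ K) (hlen : 0 ≤ len) : FillsInterval K (s * mesh) (s * len) := by
  simpa using h.union (c := 0) (c' := 0) hs (by simpa using hs') (by simpa using hs')
    (by simpa using by positivity)

/-- A set that fills an interval of length `R` finely has many points near one of its points. -/
lemma FillsInterval.exists_le_card {ρ R : ℝ} (h : FillsInterval K mesh len) (hmesh : mesh ≤ ρ)
    (hR : 0 < R) (hlen : R ≤ len) (hρR : ρ < R / 2) :
    ∃ x ∈ K, ∀ T : Finset ℝ, K ∩ Metric.ball x R ⊆ ⋃ y ∈ T, Metric.ball y ρ →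
      R ≤ 8 * T.card * ρ := by
  obtain ⟨a, ha⟩ := h
  obtain ⟨x, hx, hx1, hx2⟩ := ha a ⟨le_rfl, by linarith⟩
  refine ⟨x, hx, fun T hT => ?_⟩
  have hρ : 0 ≤ ρ := by linarith
  -- Only half of the interval is used: x may lie up to `mesh` < R/2 left of a, and the filling
  -- points must stay in B(x,R). Comparing lengths, R/2 ≤ |T|·4ρ, whence the 8.
  have hsub : Set.Icc a (a + R / 2) ⊆ ⋃ u ∈ T, Metric.closedBall u (2 * ρ) := by
    intro y hy
    obtain ⟨z, hz, hz1, hz2⟩ := ha y ⟨hy.1, by linarith [hy.2]⟩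
    have hzB : z ∈ Metric.ball x R := by
      rw [Metric.mem_ball, Real.dist_eq, abs_lt]
      constructor <;> linarith [hy.1, hy.2]
    have := hT ⟨hz, hzB⟩
    simp only [Set.mem_iUnion] at this ⊢
    obtain ⟨u, hu, hzu⟩ := this
    refine ⟨u, hu, ?_⟩
    rw [Metric.mem_ball, Real.dist_eq, abs_lt] at hzu
    rw [Metric.mem_closedBall, Real.dist_eq, abs_le]
    constructor <;> linarith [hzu.1, hzu.2]
  have hvol := (MeasureTheory.measure_mono (μ := MeasureTheory.volume) hsub).trans
    (MeasureTheory.measure_biUnion_finset_le T _)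
  simp only [Real.volume_Icc, Real.volume_closedBall, Finset.sum_const, nsmul_eq_mul] at hvol
  rw [← ENNReal.ofReal_natCast, ← ENNReal.ofReal_mul (by positivity),
    ENNReal.ofReal_le_ofReal_iff (by positivity)] at hvol
  linarith

end Fills

/-! ### Filled intervals in the three-map system -/

section ThreeMaps

variable {m : ℕ} {K : Set ℝ}

lemma one_div_pow_mul_mem (h0 : ∀ x ∈ K, 1 / (m : ℝ) * x ∈ K) (n : ℕ) :
    ∀ x ∈ K, 1 / (m : ℝ) ^ n * x ∈ K := by
  induction n with
  | zero => intro x hx; simpa using hx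
  | succ n ih =>
    intro x hx
    convert ih _ (h0 x hx) using 1
    rw [pow_succ]; ring

/-- This is the word of length N_k with the map (x+1)/m at the places N_0, …, N_k and x/m elsewhere.
-/
lemma sum_digitData_add_mem (hm : 3 ≤ m) (h0 : ∀ x ∈ K, 1 / (m : ℝ) * x ∈ K)
    (h1 : ∀ x ∈ K, 1 / (m : ℝ) * x + 1 / m ∈ K) (k : ℕ) :
    ∀ x ∈ K, ∑ i ∈ Finset.range (k + 1), 1 / (m : ℝ) ^ (digitData m i).1 +
      1 / (m : ℝ) ^ (digitData m k).1 * x ∈ K := by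
  have hm0 : (0 : ℝ) < m := by positivity
  induction k with
  | zero =>
    intro x hx
    convert h1 x hx using 1
    simp [digitData]; ring
  | succ k ih =>
    intro x hx
    obtain ⟨n, hn⟩ := Nat.exists_eq_add_of_lt (digitData_lt_succ hm k)
    convert ih _ (one_div_pow_mul_mem h0 n _ (h1 x hx)) using 1
    rw [Finset.sum_range_succ, hn, pow_succ, pow_add]
    field_simp
    ring

/-- Each step lengthens the interval, relative to its mesh, by 1 + 1/m. It overlays two copies of
ratio m^{-(p+N+1)} whose translations differ by τ/m, with τ the tail of t. The depth grows by a
bounded factor per step, so j is logarithmic in the depth. -/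
lemma exists_fillsInterval (hm : 3 ≤ m) (hzero : (0 : ℝ) ∈ K)
    (h0 : ∀ x ∈ K, 1 / (m : ℝ) * x ∈ K)
    (ht : ∀ x ∈ K, 1 / (m : ℝ) * x + sparseDigitNumber m / m ∈ K)
    (h1 : ∀ x ∈ K, 1 / (m : ℝ) * x + 1 / m ∈ K) (j : ℕ) :
    ∃ l : ℕ, l + 1 ≤ 2 ^ (3 * j + 2) ∧
      FillsInterval K (1 / (m : ℝ) ^ l) ((1 + 1 / (m : ℝ)) ^ j / (m : ℝ) ^ l) := by
  have hm3 : (3 : ℝ) ≤ m := by exact_mod_cast hm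
  have hm0 : (0 : ℝ) < m := by linarith
  have hm1 : (1 : ℝ) < m := by linarith
  induction j with
  | zero =>
    refine ⟨0, by norm_num, 0, fun y hy => ⟨0, hzero, hy.1, ?_⟩⟩
    simpa using hy.2
  | succ j ih =>
    obtain ⟨l, hl, hfill⟩ := ih
    -- This makes N ≥ l + 2. With N' ≥ 2N - 1 it gives τ m^N ≤ m^{-l} ≤ len, so an exponent p ≥ 0
    -- exists below.
    set k := 3 * j + 3 with hk
    set N := (digitData m k).1 with hN
    set N' := (digitData m (k + 1)).1 with hN'
    set len := (1 + 1 / (m : ℝ)) ^ j / (m : ℝ) ^ l with hlen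
    have hNl : l + 2 ≤ N := by
      have : 2 ^ (3 * j + 2) < N := two_pow_lt_digitData_succ hm (3 * j + 2)
      omega
    have hNN' : 2 * N ≤ N' + 1 := two_mul_digitData_le hm k
    have hN'2 : N' ≤ 2 ^ (3 * j + 4) := digitData_le_two_pow hm (k + 1)
    obtain ⟨τ, hτ⟩ : ∃ τ, τ = ∑' i : ℕ, 1 / (m : ℝ) ^ (digitData m (k + 1 + i)).1 := ⟨_, rfl⟩
    have hτ1 : 1 / (m : ℝ) ^ N' ≤ τ := hτ ▸ le_tsum_digitData hm (k + 1)
    have hτ2 : τ ≤ 2 / (m : ℝ) ^ N' := hτ ▸ tsum_digitData_le hm (k + 1)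
    have hsplit : sparseDigitNumber m =
        ∑ i ∈ Finset.range (k + 1), 1 / (m : ℝ) ^ (digitData m i).1 + τ :=
      hτ ▸ sparseDigitNumber_eq hm (k + 1)
    have hτ0 : 0 < τ := lt_of_lt_of_le (by positivity) hτ1
    have hlen0 : 0 < len := by positivity
    have hone : 1 ≤ 1 + 1 / (m : ℝ) := by
      have : 0 < 1 / (m : ℝ) := by positivity
      linarith
    have hle_m : 1 + 1 / (m : ℝ) ≤ m := by
      have : 1 / (m : ℝ) ≤ 1 := by rw [div_le_one hm0]; exact hm1.le
      linarith
    -- For s = m^{-(p+N+1)} the largest admissible p gives s·len/m < τ/m ≤ s·len: the copies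
    -- overlap, yet the union is longer by a factor at least 1 + 1/m.
    obtain ⟨p, hp1, hp2⟩ := exists_nat_pow_near (x := len / (m : ℝ) ^ N / τ) (y := (m : ℝ)) (by
      rw [one_le_div hτ0, le_div_iff₀ (by positivity)]
      calc τ * (m : ℝ) ^ N ≤ m / (m : ℝ) ^ N' * (m : ℝ) ^ N := by
            gcongr
            refine hτ2.trans ?_
            gcongr
            linarith
        _ = (m : ℝ) ^ (N + 1) / (m : ℝ) ^ N' := by ring
        _ ≤ 1 / (m : ℝ) ^ l := by
            rw [div_le_div_iff₀ (by positivity) (by positivity), ← pow_add, one_mul]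
            exact pow_le_pow_right₀ hm1.le (by omega)
        _ ≤ len := by
            rw [hlen]
            gcongr
            exact one_le_pow₀ hone) hm1
    rw [le_div_iff₀ hτ0, le_div_iff₀ (by positivity)] at hp1
    rw [div_lt_iff₀ hτ0, div_lt_iff₀ (by positivity)] at hp2
    -- The lower bound on the tail τ keeps the new depth p + N + 1 + l at most j + N' + 1.
    have hpbound : p + l + N ≤ j + N' := by
      rw [← pow_le_pow_iff_right₀ hm1]
      have e1 : len * (m : ℝ) ^ l ≤ (m : ℝ) ^ j := by
        rw [hlen, div_mul_cancel₀ _ (by positivity)]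
        gcongr
      have e2 : 1 ≤ τ * (m : ℝ) ^ N' := by
        rwa [div_le_iff₀ (by positivity)] at hτ1
      calc (m : ℝ) ^ (p + l + N) = (m : ℝ) ^ p * (m : ℝ) ^ N * (m : ℝ) ^ l * 1 := by ring
        _ ≤ (m : ℝ) ^ p * (m : ℝ) ^ N * (m : ℝ) ^ l * (τ * (m : ℝ) ^ N') := by gcongr
        _ = (m : ℝ) ^ p * τ * (m : ℝ) ^ N * ((m : ℝ) ^ l * (m : ℝ) ^ N') := by ring
        _ ≤ len * ((m : ℝ) ^ l * (m : ℝ) ^ N') := by gcongr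
        _ = len * (m : ℝ) ^ l * (m : ℝ) ^ N' := by ring
        _ ≤ (m : ℝ) ^ j * (m : ℝ) ^ N' := by gcongr
        _ = _ := by ring
    refine ⟨p + N + 1 + l, ?_, ?_⟩
    · have hj : j + 3 ≤ 2 ^ (3 * j + 4) := by
        have h := Nat.lt_two_pow_self (n := 3 * j + 4)
        omega
      have e : 2 ^ (3 * (j + 1) + 2) = 2 * 2 ^ (3 * j + 4) := by ring
      rw [e]
      omega
    · have hu := hfill.union (s := 1 / (m : ℝ) ^ (p + N + 1))
        (c := 1 / m * ∑ i ∈ Finset.range (k + 1), 1 / (m : ℝ) ^ (digitData m i).1)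
        (c' := sparseDigitNumber m / m) (by positivity)
        (fun x hx => by
          convert h0 _ (sum_digitData_add_mem hm h0 h1 k _ (one_div_pow_mul_mem h0 p x hx)) using 1
          rw [← hN]
          field_simp
          ring)
        (fun x hx => by
          convert ht _ (one_div_pow_mul_mem h0 (p + N) x hx) using 1
          field_simp
          ring)
        (by
          rw [hsplit]
          have e : (∑ i ∈ Finset.range (k + 1), 1 / (m : ℝ) ^ (digitData m i).1 + τ) / m -
            1 / m * ∑ i ∈ Finset.range (k + 1), 1 / (m : ℝ) ^ (digitData m i).1 = τ / m := by ring
          rw [e, div_mul_eq_mul_div, one_mul, div_le_div_iff₀ hm0 (by positivity)]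
          calc τ * (m : ℝ) ^ (p + N + 1) = (m : ℝ) ^ p * τ * (m : ℝ) ^ N * m := by ring
            _ ≤ len * m := by gcongr)
      have e : sparseDigitNumber m / m -
          1 / m * ∑ i ∈ Finset.range (k + 1), 1 / (m : ℝ) ^ (digitData m i).1 = τ / m := by
        rw [hsplit]; ring
      rw [e] at hu
      have e2 : 1 / (m : ℝ) ^ (p + N + 1) * (1 / (m : ℝ) ^ l) = 1 / (m : ℝ) ^ (p + N + 1 + l) := by
        rw [pow_add _ (p + N + 1) l]; field_simp
      rw [e2] at hu
      refine hu.mono ?_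
      have e3 : (1 + 1 / (m : ℝ)) ^ (j + 1) / (m : ℝ) ^ (p + N + 1 + l) =
          1 / (m : ℝ) ^ (p + N + 1) * len + 1 / (m : ℝ) ^ (p + N + 1) * len / m := by
        rw [hlen, pow_add _ (p + N + 1) l, pow_succ (1 + 1 / (m : ℝ)) j]
        field_simp
      rw [e3]
      gcongr
      rw [div_mul_eq_mul_div, one_mul, div_le_iff₀ (by positivity)]
      calc len ≤ (m : ℝ) ^ (p + 1) * τ * (m : ℝ) ^ N := hp2.le
        _ = _ := by ring

end ThreeMaps

/-! ### Comparison with the Assouad dimension -/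

lemma phiAssouadDim_le_assouadDim {φ : ℝ → ℝ} (hφ : IsDimensionFunction φ) (F : Set ℝ) :
    phiAssouadDim φ F ≤ assouadDim F := by
  refine le_iInf₂ fun s hs => ?_
  obtain ⟨C, hC, h⟩ := hs
  refine iInf₂_le s ⟨C, hC, fun R hR hR1 x hx => ?_⟩
  have hgap := hφ.gap_pos hR hR1
  have hle : R ^ (1 + φ R) ≤ R := by
    rw [rpow_one_add_eq hR]
    exact mul_le_of_le_one_right hR.le (Real.exp_le_one_iff.mpr (by linarith))
  have e : R ^ (-φ R * s) = (R / R ^ (1 + φ R)) ^ s := by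
    rw [rpow_neg_mul_eq hR, rpow_one_add_eq hR, Real.exp_neg, ← div_eq_mul_inv,
      div_div_cancel₀ hR.ne', ← Real.exp_mul]
  rw [e]
  exact h _ R (by positivity) hle hR1 x hx

lemma assouadDim_le_one {K : Set ℝ} (hK : IsCompact K) : assouadDim K ≤ 1 := by
  refine iInf₂_le (1 : ℝ) ⟨5, by norm_num, fun r R hr hrR _ x _ => ?_⟩
  have hR : 0 < R := by linarith
  obtain ⟨T, hTK, hTsep, hTcov⟩ := exists_finset_separated_cover
    (hK.inter_right (Metric.isClosed_closedBall (x := x) (ε := R))) hr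
  refine openCoveringNumber_le_ofReal (T := T) (hTK.trans Set.inter_subset_left)
    ((Set.inter_subset_inter_right K Metric.ball_subset_closedBall).trans hTcov) ?_
  -- Points of `T` are more than r/2 apart in an interval of length 2R, so their positions in units
  -- of r/2 have distinct integer parts: at most 4R/r + 1 ≤ 5R/r of them.
  have hcard : T.card ≤ (Finset.range (⌊4 * (R / r)⌋₊ + 1)).card := by
    refine Finset.card_le_card_of_injOn (fun u => ⌊(u - (x - R)) / (r / 2)⌋₊) ?_ ?_
    · intro u hu
      have := (hTK hu).2
      rw [Metric.mem_closedBall, Real.dist_eq, abs_le] at this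
      simp only [Finset.coe_range, Set.mem_Iio, Order.lt_add_one_iff]
      apply Nat.floor_le_floor
      rw [div_le_iff₀ (by positivity)]
      have e : 4 * (R / r) * (r / 2) = 2 * R := by field_simp; norm_num
      linarith
    · intro u hu v hv huv
      by_contra hne
      have hsep := hTsep u hu v hv hne
      have hu' := (hTK hu).2
      have hv' := (hTK hv).2
      rw [Metric.mem_closedBall, Real.dist_eq, abs_le] at hu' hv'
      simp only at huv
      have a1 := Nat.floor_le (show 0 ≤ (u - (x - R)) / (r / 2) by
        apply div_nonneg <;> linarith)
      have a2 := Nat.lt_floor_add_one ((u - (x - R)) / (r / 2))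
      have b1 := Nat.floor_le (show 0 ≤ (v - (x - R)) / (r / 2) by
        apply div_nonneg <;> linarith)
      have b2 := Nat.lt_floor_add_one ((v - (x - R)) / (r / 2))
      rw [huv] at a1 a2
      have : |(u - (x - R)) / (r / 2) - (v - (x - R)) / (r / 2)| < 1 := by
        rw [abs_lt]; constructor <;> linarith
      rw [← sub_div, sub_sub_sub_cancel_right, abs_div, abs_of_pos (by positivity : 0 < r / 2),
        div_lt_one (by positivity), ← Real.dist_eq] at this
      linarith
  rw [Finset.card_range] at hcard
  have h1 : 1 ≤ R / r := (one_le_div hr).mpr hrR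
  rw [Real.rpow_one]
  calc (T.card : ℝ) ≤ (⌊4 * (R / r)⌋₊ : ℝ) + 1 := by exact_mod_cast hcard
    _ ≤ 4 * (R / r) + 1 := by gcongr; exact Nat.floor_le (by positivity)
    _ ≤ 5 * (R / r) := by linarith

/-! ### The main theorem -/

/-- If balls of radius `m⁻ⁿ` contain maximally dense parts of `K` at the lower scale for
infinitely many `n`, the `φ`-Assouad dimension is at least `1`. -/
lemma one_le_phiAssouadDim_of_frequently {φ : ℝ → ℝ} (hφ : IsDimensionFunction φ) {K : Set ℝ}
    {q : ℝ} (hq : 0 < q) (hq1 : q < 1)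
    (h : ∃ᶠ n : ℕ in Filter.atTop, ∃ x ∈ K, ∀ T : Finset ℝ,
      K ∩ Metric.ball x (q ^ n) ⊆ ⋃ y ∈ T, Metric.ball y ((q ^ n) ^ (1 + φ (q ^ n))) →
        q ^ n ≤ 8 * T.card * (q ^ n) ^ (1 + φ (q ^ n))) : 1 ≤ phiAssouadDim φ K := by
  refine le_iInf₂ fun s hs => ?_
  obtain ⟨C, hC, hcov⟩ := hs
  by_contra! hlt
  have hs1 : s < 1 := by exact_mod_cast hlt
  have hlim : Filter.Tendsto (fun n : ℕ => q ^ n) Filter.atTop (𝓝[>] 0) :=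
    tendsto_nhdsWithin_iff.mpr ⟨tendsto_pow_atTop_nhds_zero_of_lt_one hq.le hq1,
      Filter.Eventually.of_forall fun n => pow_pos hq n⟩
  -- Combining both bounds on the cover gives 1 ≤ 8C e^{-G(1-s)}, which fails for s < 1 once G is
  -- large.
  obtain ⟨n, ⟨x, hx, hT⟩, hgap, hR, hR1⟩ := (h.and_eventually (hlim.eventually
    ((hφ.eventually_lt_gap (Real.log (8 * C) / (1 - s))).and
      (Ioo_mem_nhdsGT (zero_lt_one (α := ℝ)))))).exists
  obtain ⟨T, -, hTcov, hcard⟩ := exists_cover_of_openCoveringNumber_le (by positivity)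
    (hcov _ hR hR1 x hx)
  have h1 := hT T hTcov
  rw [rpow_neg_mul_eq hR] at hcard
  rw [rpow_one_add_eq hR] at h1
  set R := q ^ n
  set G := φ R * Real.log (1 / R) with hG
  rw [div_lt_iff₀ (by linarith)] at hgap
  have h2 : (1 : ℝ) ≤ 8 * T.card * Real.exp (-G) := by
    have : R * 1 ≤ R * (8 * T.card * Real.exp (-G)) := by linarith
    exact le_of_mul_le_mul_left this hR
  have h3 : 8 * T.card * Real.exp (-G) ≤ 8 * C * Real.exp (-(G * (1 - s))) := by
    calc 8 * T.card * Real.exp (-G) ≤ 8 * (C * Real.exp (G * s)) * Real.exp (-G) := by gcongr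
      _ = 8 * C * (Real.exp (G * s) * Real.exp (-G)) := by ring
      _ = _ := by rw [← Real.exp_add]; ring_nf
  have h4 : 8 * C * Real.exp (-(G * (1 - s))) < 1 := by
    rw [← Real.exp_log (show 0 < 8 * C by positivity), ← Real.exp_add, Real.exp_lt_one_iff]
    linarith
  linarith

lemma IsAttractor.zero_mem {ι : Type*} {q : ℝ} {d : ι → ℝ} {K : Set ℝ}
    (h : IsAttractor (equiIFS q d) K) (hq : 0 ≤ q) (hq1 : q < 1) {i : ι} (hi : d i = 0) :
    (0 : ℝ) ∈ K := by
  obtain ⟨x, hx⟩ := h.nonempty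
  have hmem : ∀ n : ℕ, q ^ n * x ∈ K := by
    intro n
    induction n with
    | zero => simpa using hx
    | succ n ih =>
      have := h.map_mem i ih
      rwa [equiIFS, hi, add_zero, ← mul_assoc, ← pow_succ'] at this
  have hlim := (tendsto_pow_atTop_nhds_zero_of_lt_one hq hq1).mul_const x
  rw [zero_mul] at hlim
  exact h.isCompact.isClosed.mem_of_tendsto hlim (Filter.Eventually.of_forall hmem)

/-- At scale `m⁻ⁿ` the attractor of the three maps fills an interval with relative mesh `e⁻ᴳ`,
as long as `G` is at most a small multiple of `log n`. -/
lemma exists_fillsInterval_of_log_le {m : ℕ} {K : Set ℝ} (hm : 3 ≤ m) (hzero : (0 : ℝ) ∈ K)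
    (h0 : ∀ x ∈ K, 1 / (m : ℝ) * x ∈ K)
    (ht : ∀ x ∈ K, 1 / (m : ℝ) * x + sparseDigitNumber m / m ∈ K)
    (h1 : ∀ x ∈ K, 1 / (m : ℝ) * x + 1 / m ∈ K) :
    ∃ n₀ : ℕ, ∀ n ≥ n₀, ∀ G : ℝ, 0 ≤ G →
      G ≤ Real.log (1 + 1 / (m : ℝ)) / 6 * Real.log n →
      ∃ mesh len : ℝ, FillsInterval K mesh len ∧
        mesh ≤ (1 / (m : ℝ)) ^ n * Real.exp (-G) ∧ (1 / (m : ℝ)) ^ n ≤ len := by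
  have hm3 : (3 : ℝ) ≤ m := by exact_mod_cast hm
  have hm0 : (0 : ℝ) < m := by linarith
  have hm1 : (1 : ℝ) < m := by linarith
  have hinv : 0 < 1 / (m : ℝ) := by positivity
  set lam := Real.log (1 + 1 / (m : ℝ)) with hlam
  have hlam0 : 0 < lam := Real.log_pos (by linarith)
  -- With G/lam ≤ (log n)/6 one gets 3j + 2 ≤ (log n)/2 + B, so log n ≥ 2B ensures 2^{3j+2} ≤ n and
  -- thus l ≤ n.
  set B := 3 * Real.log m / lam + 5 with hB
  have hlogm : 0 < Real.log m := Real.log_pos hm1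
  have hlim : Filter.Tendsto (fun n : ℕ => Real.log n) Filter.atTop Filter.atTop :=
    Real.tendsto_log_atTop.comp tendsto_natCast_atTop_atTop
  obtain ⟨n₀, hn₀⟩ := Filter.eventually_atTop.mp (hlim.eventually_ge_atTop (2 * B))
  refine ⟨max n₀ 1, fun n hn G hG0 hG => ?_⟩
  have hnB := hn₀ n (le_trans (le_max_left _ _) hn)
  have hn1 : (0 : ℝ) < n := by
    exact_mod_cast lt_of_lt_of_le zero_lt_one (le_trans (le_max_right _ _) hn)
  -- The extra log m buys a factor m that absorbs the rounding of p to an integer.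
  set j := ⌈(G + Real.log m) / lam⌉₊ with hj
  have hj1 : (G + Real.log m) / lam ≤ j := Nat.le_ceil _
  have hj2 : (j : ℝ) < (G + Real.log m) / lam + 1 := Nat.ceil_lt_add_one (by positivity)
  obtain ⟨l, hl, hfill⟩ := exists_fillsInterval hm hzero h0 ht h1 j
  have hpow : m * Real.exp G ≤ (1 + 1 / (m : ℝ)) ^ j := by
    rw [div_le_iff₀ hlam0] at hj1
    calc m * Real.exp G = Real.exp (G + Real.log m) := by
          rw [Real.exp_add, Real.exp_log hm0, mul_comm]
      _ ≤ Real.exp (j * lam) := Real.exp_le_exp.mpr hj1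
      _ = _ := by rw [Real.exp_nat_mul, hlam, Real.exp_log (by linarith)]
  have hln : l ≤ n := by
    have h2 : ((2 : ℝ) ^ (3 * j + 2)) ≤ n := by
      have hlog2 : Real.log 2 ≤ 1 := by linarith [Real.log_two_lt_d9]
      rw [← Real.log_le_log_iff (by positivity) hn1, Real.log_pow]
      have hGl : G / lam ≤ Real.log n / 6 := by
        rw [div_le_iff₀ hlam0]; linarith
      have hsplit : (G + Real.log m) / lam = G / lam + Real.log m / lam := add_div _ _ _
      have hBe : B = 3 * (Real.log m / lam) + 5 := by rw [hB, mul_div_assoc]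
      calc ((3 * j + 2 : ℕ) : ℝ) * Real.log 2 ≤ ((3 * j + 2 : ℕ) : ℝ) * 1 := by gcongr
        _ = 3 * j + 2 := by push_cast; ring
        _ ≤ Real.log n := by linarith
    have h3 : 2 ^ (3 * j + 2) ≤ n := by exact_mod_cast h2
    omega
  have hone : 1 ≤ (1 + 1 / (m : ℝ)) ^ j := one_le_pow₀ (by linarith)
  have hlen : 0 < (1 + 1 / (m : ℝ)) ^ j / (m : ℝ) ^ l := by positivity
  obtain ⟨p, hp1, hp2⟩ := exists_nat_pow_near
    (x := (1 + 1 / (m : ℝ)) ^ j / (m : ℝ) ^ l * (m : ℝ) ^ n) (y := (m : ℝ)) (by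
      rw [div_mul_eq_mul_div, one_le_div (by positivity)]
      calc (m : ℝ) ^ l ≤ 1 * (m : ℝ) ^ n := by
            rw [one_mul]; exact pow_le_pow_right₀ hm1.le hln
        _ ≤ _ := by gcongr) hm1
  refine ⟨_, _, hfill.scale (s := 1 / (m : ℝ) ^ p) (by positivity)
    (one_div_pow_mul_mem h0 p) hlen.le, ?_, ?_⟩
  · rw [div_mul_eq_mul_div, div_lt_iff₀ (by positivity)] at hp2
    have key : (m : ℝ) ^ n * Real.exp G ≤ (m : ℝ) ^ p * (m : ℝ) ^ l := by
      have : m * Real.exp G * (m : ℝ) ^ n ≤ (m : ℝ) ^ (p + 1) * (m : ℝ) ^ l :=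
        (mul_le_mul_of_nonneg_right hpow (by positivity)).trans hp2.le
      refine le_of_mul_le_mul_left (a := (m : ℝ)) ?_ hm0
      calc m * ((m : ℝ) ^ n * Real.exp G) = m * Real.exp G * (m : ℝ) ^ n := by ring
        _ ≤ _ := this
        _ = _ := by ring
    rw [one_div_pow, Real.exp_neg, one_div_mul_one_div, ← one_div, one_div_mul_one_div]
    exact one_div_le_one_div_of_le (by positivity) key
  · rw [one_div_pow, div_le_iff₀ (by positivity)]
    calc (1 : ℝ) = 1 / (m : ℝ) ^ p * (m : ℝ) ^ p := by field_simp
      _ ≤ 1 / (m : ℝ) ^ p * ((1 + 1 / (m : ℝ)) ^ j / (m : ℝ) ^ l * (m : ℝ) ^ n) := by gcongr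
      _ = _ := by ring

/-- The attractor of the three maps has full `φ`-Assouad dimension for small `φ`. -/
lemma one_le_phiAssouadDim_threeTranslations {m : ℕ} (hm : 3 ≤ m) {K : Set ℝ}
    (hK : IsAttractor (equiIFS (1 / (m : ℝ)) (threeTranslations m)) K) {φ : ℝ → ℝ}
    (hφ : IsDimensionFunction φ)
    (hlim : ((12 * Real.log m / Real.log (1 + 1 / (m : ℝ)) : ℝ) : EReal) ≤ Filter.limsup
      (fun n : ℕ => ((Real.log (n : ℝ) / ((n : ℝ) * φ ((1 / (m : ℝ)) ^ n)) : ℝ) : EReal))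
      Filter.atTop) : 1 ≤ phiAssouadDim φ K := by
  have hm3 : (3 : ℝ) ≤ m := by exact_mod_cast hm
  have hm0 : (0 : ℝ) < m := by linarith
  have hq : 0 < 1 / (m : ℝ) := by positivity
  have hq1 : 1 / (m : ℝ) < 1 := by rw [div_lt_one hm0]; linarith
  have hlogm : 0 < Real.log m := Real.log_pos (by linarith)
  have hlam0 : 0 < Real.log (1 + 1 / (m : ℝ)) := Real.log_pos (by linarith)
  have hzero : (0 : ℝ) ∈ K := hK.zero_mem hq.le hq1 (i := 0) rfl
  obtain ⟨n₀, hn₀⟩ := exists_fillsInterval_of_log_le hm hzero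
    (fun x hx => by simpa [equiIFS, threeTranslations] using hK.map_mem 0 hx)
    (fun x hx => by simpa [equiIFS, threeTranslations] using hK.map_mem 1 hx)
    (fun x hx => by simpa [equiIFS, threeTranslations] using hK.map_mem 2 hx)
  set lam := Real.log (1 + 1 / (m : ℝ)) with hlam
  apply one_le_phiAssouadDim_of_frequently hφ hq hq1
  have hfreq : ∃ᶠ n : ℕ in Filter.atTop,
      6 * Real.log m / lam < Real.log (n : ℝ) / ((n : ℝ) * φ ((1 / (m : ℝ)) ^ n)) := by
    -- A limsup that is at least C exceeds only smaller numbers infinitely often; the constant 12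
    -- leaves room for the 6 that is needed.
    have hlt : ((6 * Real.log m / lam : ℝ) : EReal) < ((12 * Real.log m / lam : ℝ) : EReal) := by
      rw [EReal.coe_lt_coe_iff]
      gcongr
      norm_num
    refine (Filter.frequently_lt_of_lt_limsup (by isBoundedDefault)
      (hlt.trans_le hlim)).mono fun n hn => ?_
    exact_mod_cast hn
  have hscale : Filter.Tendsto (fun n : ℕ => (1 / (m : ℝ)) ^ n) Filter.atTop (𝓝[>] 0) :=
    tendsto_nhdsWithin_iff.mpr ⟨tendsto_pow_atTop_nhds_zero_of_lt_one hq.le hq1,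
      Filter.Eventually.of_forall fun n => pow_pos hq n⟩
  refine (hfreq.and_eventually ((hscale.eventually (hφ.eventually_lt_gap (Real.log 2))).and
    (Filter.eventually_ge_atTop (max n₀ 1)))).mono fun n hn => ?_
  obtain ⟨hlog, hgap, hn⟩ := hn
  have hnpos : 0 < n := lt_of_lt_of_le zero_lt_one (le_trans (le_max_right _ _) hn)
  have hn0 : (0 : ℝ) < n := by exact_mod_cast hnpos
  set R := (1 / (m : ℝ)) ^ n with hRdef
  have hR : 0 < R := pow_pos hq n
  have hR1 : R < 1 := pow_lt_one₀ hq.le hq1 hnpos.ne'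
  have hφR : 0 < φ R := hφ.pos R ⟨hR, hR1⟩
  have hG : φ R * Real.log (1 / R) = n * φ R * Real.log m := by
    rw [hRdef, one_div_pow, one_div_one_div, Real.log_pow]; ring
  set G := φ R * Real.log (1 / R) with hGdef
  have hGle : G ≤ lam / 6 * Real.log n := by
    rw [lt_div_iff₀ (by positivity), div_mul_eq_mul_div, div_lt_iff₀ hlam0] at hlog
    rw [hG]
    linarith
  have hG0 : 0 < G := hφ.gap_pos hR hR1
  obtain ⟨mesh, len, hfill, hmesh, hlen⟩ := hn₀ n (le_trans (le_max_left _ _) hn) G hG0.le hGle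
  rw [rpow_one_add_eq hR, ← hGdef]
  refine hfill.exists_le_card hmesh hR hlen ?_
  -- G > log 2 makes the lower scale R e^{-G} smaller than R/2.
  have := Real.exp_lt_exp.mpr (neg_lt_neg hgap)
  rw [Real.exp_neg (Real.log 2), Real.exp_log (by norm_num)] at this
  calc R * Real.exp (-G) < R * 2⁻¹ := by gcongr
    _ = R / 2 := by ring

theorem theoremG :
    (∀ (ι : Type*) [Finite ι] (r : ℝ) (d : ι → ℝ) (K : Set ℝ) (φ : ℝ → ℝ),
      0 < r → r < 1 → IsAttractor (equiIFS r d) K → IsDimensionFunction φ →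
      Filter.Tendsto
        (fun n : ℕ => Real.log (overlapCount r d K n : ℝ) / ((n : ℝ) * φ (r ^ n)))
        Filter.atTop (𝓝 0) →
      phiAssouadDim φ K = (dimH K : EReal)) ∧
    (∀ m : ℕ, 3 ≤ m →
      0 < sparseDigitNumber m ∧ sparseDigitNumber m < 1 ∧
      ∃ K : Set ℝ, IsAttractor (equiIFS (1 / (m : ℝ)) (threeTranslations m)) K ∧
        ∃ C : ℝ, 0 < C ∧ ∀ φ : ℝ → ℝ, IsDimensionFunction φ →
          (C : EReal) ≤ Filter.limsup
            (fun n : ℕ => ((Real.log (n : ℝ) / ((n : ℝ) * φ ((1 / (m : ℝ)) ^ n)) : ℝ) : EReal))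
            Filter.atTop →
          phiAssouadDim φ K = 1 ∧ assouadDim K = 1) := by
  refine ⟨fun ι _ r d K φ hr hr1 hK hφ hlim => hK.phiAssouadDim_eq_dimH hr hr1 hφ hlim,
    fun m hm => ⟨sparseDigitNumber_pos hm, sparseDigitNumber_lt_one hm, ?_⟩⟩
  have hm3 : (3 : ℝ) ≤ m := by exact_mod_cast hm
  have hm0 : (0 : ℝ) < m := by linarith
  have hq : 0 < 1 / (m : ℝ) := by positivity
  obtain ⟨K, hK⟩ := exists_isAttractor (threeTranslations m) hq
    (by rw [div_lt_one hm0]; linarith)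
  refine ⟨K, hK, 12 * Real.log m / Real.log (1 + 1 / (m : ℝ)), ?_, fun φ hφ hlim => ?_⟩
  · have h1 : 0 < Real.log m := Real.log_pos (by linarith)
    have h2 : 0 < Real.log (1 + 1 / (m : ℝ)) := Real.log_pos (by linarith)
    positivity
  have hge := one_le_phiAssouadDim_threeTranslations hm hK hφ hlim
  have hle := phiAssouadDim_le_assouadDim hφ K
  have hone := assouadDim_le_one hK.isCompact
  exact ⟨le_antisymm (hle.trans hone) hge, le_antisymm hone (hge.trans hle)⟩
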